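/- Conventions. All graphs are finite and undirected, possibly with loops and multiple edges. For vertices $u\neq v$ of a graph $G$, $d_G(u)$ is the degree of $u$ (each loop contributes $2$), $\ell_G(u)$ is the number of loops at $u$, and $m_G(u,v)$ is the number of edges joining $u$ and $v$. For real $x,y$ write $x\approx y$ if $\lfloor y\rfloor\le x\le\lceil y\rceil$. A $k$-edge-coloring assigns to each edge a color $j\in\{1,\dots,k\}$; $G(j)$ denotes the subgraph of $G$ induced by the edges of color $j$, i.e. its edges are those of color $j$ and its vertices are the ends of these edges. A vertex $u$ of $G$ outside $G(j)$ has $d_{G(j)}(u)=\ell_{G(j)}(u)=m_{G(j)}(u,v)=0$. $\omega(G)$ is the number of components of $G$. For $\eta:V(H)\to\{1,2,3,\dots\}$, a graph $G$ is an $\eta$-detachment of $H$ with amalgamation function $\psi$ if $\psi$ maps $V(G)$ onto $V(H)$ with $|\psi^{-1}(w)|=\eta(w)$ for each $w\in V(H)$, and there is a bijection $\psi':E(G)\to E(H)$ such that, for every edge $e$ of $G$ with ends $u,v$, the edge $\psi'(e)$ of $H$ has ends $\psi(u),\psi(v)$. If $H$ is edge-colored, then $e\in E(G)$ receives the color of $\psi'(e)$.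 Theorem. Let $H$ be a $k$-edge-colored graph and let $\eta:V(H)\to\{1,2,3,\dots\}$ be such that for each $w\in V(H)$, $\eta(w)=1$ implies $\ell_H(w)=0$. Then there exists a loopless $\eta$-detachment $G$ of $H$, with amalgamation function $\psi:V(G)\to V(H)$, such that: (A1) $d_G(u)\approx d_H(w)/\eta(w)$ for each $w\in V(H)$ and each $u\in\psi^{-1}(w)$; (A2) $d_{G(j)}(u)\approx d_{H(j)}(w)/\eta(w)$ for each $w\in V(H)$, each $u\in\psi^{-1}(w)$ and each color $j$; (A3) $m_G(u,u')\approx \ell_H(w)/\binom{\eta(w)}{2}$ for each $w\in V(H)$ with $\eta(w)\ge 2$ and every pair of distinct vertices $u,u'\in\psi^{-1}(w)$; (A4) $m_{G(j)}(u,u')\approx \ell_{H(j)}(w)/\binom{\eta(w)}{2}$ for each $w\in V(H)$ with $\eta(w)\ge 2$, every pair of distinct vertices $u,u'\in\psi^{-1}(w)$ and each color $j$; (A5) $m_G(u,v)\approx m_H(w,z)/(\eta(w)\eta(z))$ for every pair of distinct vertices $w,z\in V(H)$, each $u\in\psi^{-1}(w)$ and each $v\in\psi^{-1}(z)$; (A6)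 $m_{G(j)}(u,v)\approx m_{H(j)}(w,z)/(\eta(w)\eta(z))$ for every pair of distinct vertices $w,z\in V(H)$, each $u\in\psi^{-1}(w)$, each $v\in\psi^{-1}(z)$ and each color $j$; (A7) for each color $j$ such that $d_{H(j)}(w)/\eta(w)$ is an even integer for every $w\in V(H)$, $\omega(G(j))=\omega(H(j))$. -/

import Mathlib

open scoped Graph

universe u v

namespace Graph

variable {α β γ δ : Type*}

/-- The relation `x ≈ y` on the reals: `⌊y⌋ ≤ x ≤ ⌈y⌉` (it is not symmetric). -/
def Approx (x y : ℝ) : Prop := (⌊y⌋ : ℝ) ≤ x ∧ x ≤ (⌈y⌉ : ℝ)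

/-- The number of loops incident with `u`. -/
noncomputable def numLoops (G : Graph α β) (u : α) : ℕ := (G.loopSet u).ncard

/-- The degree of `u`; every loop at `u` contributes two. -/
noncomputable def deg (G : Graph α β) (u : α) : ℕ :=
  {e | G.IsNonloopAt e u}.ncard + 2 * G.numLoops u

/-- The multiplicity of a pair of vertices: the number of edges joining `u` and `v`. -/
noncomputable def mult (G : Graph α β) (u v : α) : ℕ := {e | G.IsLink e u v}.ncard

/-- The subgraph of `G` induced by the edges of colour `j`: its edges are the edges of `G` of
colour `j`, its vertices are the ends of these edges. -/
def colorClass {C : Type*} (G : Graph α β) (c : β → C) (j : C) : Graph α β where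
  vertexSet := {x | ∃ e, G.Inc e x ∧ c e = j}
  IsLink e x y := G.IsLink e x y ∧ c e = j
  isLink_symm := fun _ _ => ⟨fun _ _ h => ⟨h.1.symm, h.2⟩⟩
  eq_or_eq_of_isLink_of_isLink := fun _ _ _ _ _ h h' => h.1.left_eq_or_eq h'.1
  left_mem_of_isLink := fun e _ _ h => ⟨e, h.1.inc_left, h.2⟩

/-- The number of components of `G`. `Quot` divides the vertex set by the equivalence relation
generated by adjacency, that is, by being joined by a walk. -/
noncomputable def numComponents (G : Graph α β) : ℕ :=
  Nat.card (Quot fun x y : V(G) => G.Adj x y)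

/-- `H` is an amalgamation of `G` (and `G` is a detachment of `H`), with amalgamation function `φ`
from `V(G)` onto `V(H)` and accompanying bijection `φ'` from `E(G)` to `E(H)`: an edge with ends
`u`, `v` of `G` corresponds to an edge with ends `φ u`, `φ v` of `H`. -/
structure IsAmalgamation (G : Graph γ δ) (H : Graph α β) (φ : γ → α) (φ' : δ → β) : Prop where
  image_vertexSet : φ '' V(G) = V(H)
  bijOn_edgeSet : Set.BijOn φ' E(G) E(H)
  isLink : ∀ e u v, G.IsLink e u v → H.IsLink (φ' e) (φ u) (φ v)

/-- `G` is an `η`-detachment of `H` with amalgamation function `φ`, and `η` is the number function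
associated with `φ`: each vertex `w` of `H` splits into `η w` vertices of `G`. -/
structure IsDetachment (G : Graph γ δ) (H : Graph α β) (η : α → ℕ) (φ : γ → α) (φ' : δ → β) :
    Prop extends IsAmalgamation G H φ φ' where
  ncard_fiber : ∀ w ∈ V(H), {u ∈ V(G) | φ u = w}.ncard = η w

end Graph

/-! Cut every edge into two darts (half-edges) and split the vertices gradually. While `n` future
vertices still coincide at `y`, one of them, `v`, is split off by choosing a set `A` of darts at `y`
and moving their ends to `v`. The choice should take about a fraction `1 / n` of the darts at `y`:
of all of them, of those of each color, of those going to each vertex, of those going to each vertex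
in each color, and of those in each component of a color class cut open at `y`.

These classes come from two chains of equivalence relations, so Nash-Williams' lemma
`exists_balanced_finset` supplies `A`. Each chain yields a pairing of the darts, the union of two
pairings is bipartite, and a 2-coloring of it halves every class. Repeated halving makes an
`n`-coloring equitable, and one color class serves as `A`.

Rounding errors do not accumulate, because `FairShare` keeps a count between the same integral
multiples of its weight at each split and is transitive. When all weights are one, it becomes the
relation `≈`.

If all degrees in a color are even, each component cut open at `y` has an even number of darts
there. Should it have any, balance with `n ≥ 2` leaves one of them at `y`, so `v` stays connected to
`y` in that color. Divisibility of the degrees by `2 * η w` makes the shares exact, and so preserves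
evenness at every split. This gives the statement on components. -/

/-! ### Pairings, bisections and equitable colorings for two chains of equivalence relations. -/

section Balance

open Function Finset

open scoped Classical in
/-- An involution compatible with `r` extends to one that fixes at most one point of `S` in each
class of `r`. -/
theorem exists_involutive_extend {M : Type*} [Fintype M] (r : Setoid M) (S : Set M) (σ : M → M)
    (hσ : Involutive σ) (hS : ∀ x, x ∉ S → σ x = x) (hr : ∀ x, r (σ x) x) :
    ∃ τ : M → M, Involutive τ ∧ (∀ x, x ∉ S → τ x = x) ∧ (∀ x, r (τ x) x) ∧
      (∀ x, σ x ≠ x → τ x = σ x) ∧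
      ∀ x ∈ S, ∀ y ∈ S, r x y → τ x = x → τ y = y → x = y := by
  induction hn : #{x | σ x = x} using Nat.strong_induction_on generalizing σ with
  | _ n ih =>
  by_cases hc : ∀ x ∈ S, ∀ y ∈ S, r x y → σ x = x → σ y = y → x = y
  · exact ⟨σ, hσ, hS, hr, fun _ _ => rfl, hc⟩
  push Not at hc
  obtain ⟨x, hx, y, hy, hxy, fx, fy, hne⟩ := hc
  have key : ∀ z, σ z = x → z = x := fun z hz => by rw [← hσ z, hz, fx]
  have key' : ∀ z, σ z = y → z = y := fun z hz => by rw [← hσ z, hz, fy]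
  -- Pairing two leftover points of one class lowers the number of fixed points, on which the
  -- induction runs.
  let σ' : M → M := fun z => if z = x then y else if z = y then x else σ z
  have hσ'x : σ' x = y := by simp [σ']
  have hσ'y : σ' y = x := by simp [σ', hne.symm]
  have hσ'z : ∀ z, z ≠ x → z ≠ y → σ' z = σ z := fun z h1 h2 => by simp [σ', h1, h2]
  have hcard : #{z | σ' z = z} < n := by
    rw [← hn]
    refine card_lt_card ⟨fun z => ?_, fun h => ?_⟩
    · simp only [mem_filter, mem_univ, true_and]
      grind
    · have := @h x (by simp [fx])
      simp [hσ'x, hne.symm] at this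
  obtain ⟨τ, h1, h2, h3, h4, h5⟩ := ih _ hcard σ'
    (fun z => by
      by_cases h1 : z = x
      · rw [h1, hσ'x, hσ'y]
      by_cases h2 : z = y
      · rw [h2, hσ'y, hσ'x]
      rw [hσ'z z h1 h2, hσ'z _ (fun h => h1 (key z h)) (fun h => h2 (key' z h)), hσ z])
    (fun z hz => by
      rw [hσ'z z (fun h => hz (h ▸ hx)) (fun h => hz (h ▸ hy)), hS z hz])
    (fun z => by
      by_cases h1 : z = x
      · rw [h1, hσ'x]; exact r.symm hxy
      by_cases h2 : z = y
      · rw [h2, hσ'y]; exact hxy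
      rw [hσ'z z h1 h2]; exact hr z) rfl
  refine ⟨τ, h1, h2, h3, fun z hz => ?_, h5⟩
  have e1 : σ' z = σ z := hσ'z z (by rintro rfl; exact hz fx) (by rintro rfl; exact hz fy)
  rw [h4 z (by rwa [e1]), e1]

/-- For a chain of equivalence relations, there is a pairing on `S` such that every class of every
relation contains at most one point of `S` that is not paired inside the class. -/
theorem exists_involutive_of_chain {M : Type*} [Fintype M] (S : Set M) (𝓛 : List (Setoid M))
    (h𝓛 : 𝓛.Pairwise (· ≥ ·)) (r₀ : Setoid M) (h₀ : ∀ r ∈ 𝓛, r ≤ r₀) :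
    ∃ σ : M → M, Involutive σ ∧ (∀ x, x ∉ S → σ x = x) ∧ (∀ x, r₀ (σ x) x) ∧
      ∀ r ∈ 𝓛, ∀ x ∈ S, ∀ y ∈ S, r x y → (σ x = x ∨ ¬ r (σ x) x) → (σ y = y ∨ ¬ r (σ y) y) →
        x = y := by
  induction 𝓛 generalizing r₀ with
  | nil => exact ⟨id, fun _ => rfl, fun _ _ => rfl, fun x => r₀.refl x, by simp⟩
  | cons r 𝓛 ih =>
    rw [List.pairwise_cons] at h𝓛
    -- The list runs from coarse to fine. Points are paired inside the finer classes first; `r` then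
    -- pairs only points still fixed, so no earlier pair is broken.
    obtain ⟨σ, h1, h2, h3, h4⟩ := ih h𝓛.2 r h𝓛.1
    obtain ⟨τ, t1, t2, t3, t4, t5⟩ := exists_involutive_extend r S σ h1 h2 h3
    refine ⟨τ, t1, t2, fun x => h₀ r (by simp) (t3 x), fun q hq x hx y hy hxy bx bY => ?_⟩
    rcases List.mem_cons.1 hq with rfl | hq
    · exact t5 x hx y hy hxy (bx.resolve_right (not_not.2 (t3 x)))
        (bY.resolve_right (not_not.2 (t3 y)))
    · have bad : ∀ z, (τ z = z ∨ ¬ q (τ z) z) → (σ z = z ∨ ¬ q (σ z) z) := fun z hz => by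
        by_cases h : σ z = z
        · exact Or.inl h
        · rwa [t4 z h] at hz
      exact h4 q hq x hx y hy hxy (bad x bx) (bad y bY)

/-- Conjugation by `σ` inverts `ρ = σ * τ`, so `σ` permutes the cycles of `ρ`. It fixes none: `σ x =
ρ ^ k x` would give a fixed point of `σ` (`k` even) or of `τ` (`k` odd) halfway between. Hence `σ`
and `τ` both exchange the two cycles of a couple, and the color records which of the two is smaller
in an arbitrary order. -/
theorem exists_bool_coloring_of_fixedPointFree {M : Type*} (σ τ : Equiv.Perm M)
    (hσ : ∀ x, σ (σ x) = x) (hτ : ∀ x, τ (τ x) = x) (fσ : ∀ x, σ x ≠ x) (fτ : ∀ x, τ x ≠ x) :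
    ∃ χ : M → Bool, (∀ x, χ (σ x) ≠ χ x) ∧ ∀ x, χ (τ x) ≠ χ x := by
  classical
  have hσ1 : σ * σ = 1 := Equiv.ext hσ
  have hτ1 : τ * τ = 1 := Equiv.ext hτ
  have hσi : σ⁻¹ = σ := inv_eq_of_mul_eq_one_left hσ1
  have hτi : τ⁻¹ = τ := inv_eq_of_mul_eq_one_left hτ1
  set ρ := σ * τ with hρ
  have conj : σ * ρ * σ⁻¹ = ρ⁻¹ := by
    rw [hρ, mul_inv_rev, hσi, hτi, ← mul_assoc, hσ1, one_mul]
  have conj' : ∀ (k : ℤ) x, σ ((ρ ^ k) x) = (ρ ^ (-k)) (σ x) := by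
    intro k x
    have : σ * ρ ^ k = ρ ^ (-k) * σ := by
      rw [zpow_neg, ← inv_zpow, ← conj, conj_zpow]; group
    exact congrArg (fun f : Equiv.Perm M => f x) this
  have hτρ : ∀ x, τ x = σ (ρ x) := fun x => by simp [hρ, hσ]
  let s := Equiv.Perm.SameCycle.setoid ρ
  have not_same : ∀ x, ¬ ρ.SameCycle x (σ x) := by
    rintro x ⟨k, hk⟩
    rcases Int.even_or_odd' k with ⟨m, rfl | rfl⟩
    · apply fσ ((ρ ^ m) x)
      rw [conj', ← hk, ← Equiv.Perm.mul_apply, ← zpow_add]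
      congr 2; ring
    · apply fτ ((ρ ^ m) x)
      rw [hτρ, ← Equiv.Perm.mul_apply ρ, ← zpow_one_add, conj', ← hk, ← Equiv.Perm.mul_apply,
        ← zpow_add]
      congr 2; ring
  have map_same : ∀ x y, ρ.SameCycle x y → ρ.SameCycle (σ x) (σ y) := by
    rintro x y ⟨k, rfl⟩
    exact ⟨-k, (conj' k x).symm⟩
  let _ : LinearOrder (Quotient s) := WellOrderingRel.isWellOrder.linearOrder
  have q1 : ∀ x y, ρ.SameCycle x y → (⟦x⟧ : Quotient s) = ⟦y⟧ := fun x y h => Quotient.sound h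
  have flip : ∀ x, decide ((⟦σ x⟧ : Quotient s) < ⟦σ (σ x)⟧) ≠
      decide ((⟦x⟧ : Quotient s) < ⟦σ x⟧) := by
    intro x
    rw [hσ]
    have hne : (⟦x⟧ : Quotient s) ≠ ⟦σ x⟧ := fun h => not_same x (Quotient.exact h)
    rcases lt_or_gt_of_ne hne with h | h
    · simp [h, h.le]
    · simp [h, h.le]
  refine ⟨fun x => decide ((⟦x⟧ : Quotient s) < ⟦σ x⟧), flip, fun x => ?_⟩
  have e : (⟦x⟧ : Quotient s) = ⟦ρ x⟧ := q1 _ _ ⟨1, by simp⟩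
  have e' : (⟦σ x⟧ : Quotient s) = ⟦σ (ρ x)⟧ := q1 _ _ (map_same _ _ ⟨1, by simp⟩)
  show decide ((⟦τ x⟧ : Quotient s) < ⟦σ (τ x)⟧) ≠ decide ((⟦x⟧ : Quotient s) < ⟦σ x⟧)
  rw [e, e', hτρ]
  exact flip (ρ x)

/-- The union of two pairings is bipartite. -/
theorem exists_bool_coloring_of_involutive {M : Type*} (σ τ : M → M) (hσ : Involutive σ)
    (hτ : Involutive τ) :
    ∃ χ : M → Bool, (∀ x, σ x ≠ x → χ (σ x) ≠ χ x) ∧ ∀ x, τ x ≠ x → χ (τ x) ≠ χ x := by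
  classical
  -- Fixed points are removed by doubling `M`: each is paired with its copy. The coloring is then
  -- read off on one copy.
  let F : (M → M) → M × Bool → M × Bool := fun f x => if f x.1 = x.1 then (x.1, !x.2)
    else (f x.1, x.2)
  have hF : ∀ f : M → M, Involutive f → Involutive (F f) := by
    rintro f hf ⟨x, b⟩
    by_cases h : f x = x
    · simp [F, h]
    · simp [F, h, hf x, Ne.symm h]
  have hF' : ∀ f : M → M, ∀ x, F f x ≠ x := by
    rintro f ⟨x, b⟩
    by_cases h : f x = x <;> simp [F, h]
  obtain ⟨χ, h1, h2⟩ := exists_bool_coloring_of_fixedPointFree (hF σ hσ).toPerm (hF τ hτ).toPerm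
    (hF σ hσ) (hF τ hτ) (hF' σ) (hF' τ)
  refine ⟨fun x => χ (x, true), fun x hx => ?_, fun x hx => ?_⟩
  · simpa [F, hx] using h1 (x, true)
  · simpa [F, hx] using h2 (x, true)

/-- If a `Bool`-coloring alternates along a pairing that leaves at most one point of `P` unpaired,
then its two color classes have almost the same size in `P`. -/
theorem card_filter_le_of_pairing {M : Type*} [DecidableEq M] (P : Finset M) (σ : M → M)
    (hσ : Involutive σ) (χ : M → Bool) (hχ : ∀ x, σ x ≠ x → χ (σ x) ≠ χ x)
    (h : ∀ x ∈ P, ∀ y ∈ P, (σ x = x ∨ σ x ∉ P) → (σ y = y ∨ σ y ∉ P) → x = y) (b : Bool) :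
    #{x ∈ P | χ x = b} ≤ #{x ∈ P | χ x = !b} + 1 := by
  have h1 : #{x ∈ P | χ x = b ∧ (σ x = x ∨ σ x ∉ P)} ≤ 1 := by
    rw [card_le_one]
    intro x hx y hy
    simp only [mem_filter] at hx hy
    exact h x hx.1 y hy.1 hx.2.2 hy.2.2
  have h2 : #{x ∈ P | χ x = b ∧ ¬ (σ x = x ∨ σ x ∉ P)} ≤ #{x ∈ P | χ x = !b} := by
    refine card_le_card_of_injOn σ (fun x hx => ?_) hσ.injective.injOn
    simp only [coe_filter, Set.mem_ofPred_eq, not_or, not_not] at hx ⊢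
    refine ⟨hx.2.2.2, ?_⟩
    have := hχ x hx.2.2.1
    rw [hx.2.1] at this
    simpa using Bool.eq_not_of_ne this
  have h3 : #{x ∈ P | χ x = b} = #{x ∈ P | χ x = b ∧ (σ x = x ∨ σ x ∉ P)} +
      #{x ∈ P | χ x = b ∧ ¬ (σ x = x ∨ σ x ∉ P)} := by
    rw [← filter_filter, ← filter_filter, card_filter_add_card_filter_not]
  omega

/-- A family of finite sets is *splittable* if every set `S` has a bisection that bisects the trace
on `S` of every member of the family as equally as possible. -/
def Splittable {M : Type*} [DecidableEq M] (𝓟 : Set (Finset M)) : Prop :=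
  ∀ S : Finset M, ∃ χ : M → Bool, ∀ P ∈ 𝓟, ∀ b,
    #{x ∈ S ∩ P | χ x = b} ≤ #{x ∈ S ∩ P | χ x = !b} + 1

/-- One pairing per chain leaves at most one point of `S` unpaired in each class. A coloring that
alternates along both pairings therefore bisects the classes of both chains. -/
theorem splittable_of_chains {M : Type*} [Fintype M] [DecidableEq M] (𝓐 𝓑 : List (Setoid M))
    (h𝓐 : 𝓐.Pairwise (· ≥ ·)) (h𝓑 : 𝓑.Pairwise (· ≥ ·)) :
    Splittable {P : Finset M | ∃ r ∈ 𝓐 ++ 𝓑, ∃ x, ∀ z, z ∈ P ↔ r z x} := by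
  intro S
  obtain ⟨σ, s1, s2, -, s4⟩ := exists_involutive_of_chain (S : Set M) 𝓐 h𝓐 ⊤ (fun _ _ => le_top)
  obtain ⟨τ, t1, t2, -, t4⟩ := exists_involutive_of_chain (S : Set M) 𝓑 h𝓑 ⊤ (fun _ _ => le_top)
  obtain ⟨χ, hχ, hχ'⟩ := exists_bool_coloring_of_involutive σ τ s1 t1
  have aux : ∀ (σ : M → M) (r : Setoid M) (w : M) (P : Finset M),
      (∀ z, z ∈ P ↔ r z w) → Involutive σ → (∀ x, x ∉ (S : Set M) → σ x = x) →
      (∀ x ∈ (S : Set M), ∀ y ∈ (S : Set M), r x y → (σ x = x ∨ ¬ r (σ x) x) →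
        (σ y = y ∨ ¬ r (σ y) y) → x = y) →
      ∀ x ∈ S ∩ P, ∀ y ∈ S ∩ P, (σ x = x ∨ σ x ∉ S ∩ P) →
        (σ y = y ∨ σ y ∉ S ∩ P) → x = y := by
    intro σ r w P hP s1 s2 s4 x hx y hy bx bY
    simp only [mem_inter, hP] at hx hy bx bY
    have key : ∀ z, z ∈ S → r z w → (σ z = z ∨ ¬ (σ z ∈ S ∧ r (σ z) w)) →
        (σ z = z ∨ ¬ r (σ z) z) := by
      intro z hz hzw h
      refine h.imp_right fun h hr => h ⟨?_, r.trans hr hzw⟩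
      by_contra hS
      have := s2 _ (by simpa using hS)
      rw [s1] at this
      exact hS (this ▸ hz)
    exact s4 x hx.1 y hy.1 (r.trans hx.2 (r.symm hy.2)) (key x hx.1 hx.2 bx) (key y hy.1 hy.2 bY)
  refine ⟨χ, ?_⟩
  rintro P ⟨r, hr, w, hP⟩ b
  rcases List.mem_append.1 hr with hr | hr
  · exact card_filter_le_of_pairing _ σ s1 χ hχ (aux σ r w P hP s1 s2 (s4 r hr)) b
  · exact card_filter_le_of_pairing _ τ t1 χ hχ' (aux τ r w P hP t1 t2 (t4 r hr)) b

/-- A splittable family has equitable colorings with any positive number of colors. -/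
theorem Splittable.exists_coloring {M : Type*} [Fintype M] [DecidableEq M] {𝓟 : Set (Finset M)}
    (h : Splittable 𝓟) (n : ℕ) (hn : 0 < n) :
    ∃ f : M → Fin n, ∀ P ∈ 𝓟, ∀ i j, #{x ∈ P | f x = i} ≤ #{x ∈ P | f x = j} + 1 := by
  classical
  -- A minimizer of the sum of squares is equitable: if colors `i` and `j` differed by two or more
  -- on `P`, bisecting their union anew would increase no term and decrease the one of `P`.
  let Φ : (M → Fin n) → ℕ := fun f => ∑ P : Finset M with P ∈ 𝓟, ∑ i, #{x ∈ P | f x = i} ^ 2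
  have : Nonempty (M → Fin n) := ⟨fun _ => ⟨0, hn⟩⟩
  obtain ⟨f, hf⟩ : ∃ f, ∀ g, Φ f ≤ Φ g := ⟨_, fun g => Function.argmin_le Φ g⟩
  refine ⟨f, fun P hP i j => ?_⟩
  by_contra! hlt
  have hij : i ≠ j := by rintro rfl; omega
  obtain ⟨χ, hχ⟩ := h {x | f x = i ∨ f x = j}
  let g : M → Fin n := fun x => if f x = i ∨ f x = j then (if χ x then i else j) else f x
  have other : ∀ Q : Finset M, ∀ k, k ≠ i → k ≠ j → #{x ∈ Q | g x = k} = #{x ∈ Q | f x = k} := by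
    intro Q k h1 h2
    congr 1
    apply filter_congr
    intro x _
    simp only [g]
    split_ifs with h3 h4
    · exact ⟨fun h => absurd h.symm h1, fun h => by rcases h3 with h3 | h3 <;> simp_all⟩
    · exact ⟨fun h => absurd h.symm h2, fun h => by rcases h3 with h3 | h3 <;> simp_all⟩
    · rfl
  have gi : ∀ Q : Finset M, #{x ∈ Q | g x = i} =
      #{x ∈ ({x | f x = i ∨ f x = j} : Finset M) ∩ Q | χ x = true} := by
    intro Q
    congr 1
    ext x
    simp only [mem_filter, mem_inter, mem_univ, true_and, g]
    grind
  have gj : ∀ Q : Finset M, #{x ∈ Q | g x = j} =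
      #{x ∈ ({x | f x = i ∨ f x = j} : Finset M) ∩ Q | χ x = false} := by
    intro Q
    congr 1
    ext x
    simp only [mem_filter, mem_inter, mem_univ, true_and, g]
    grind
  have total : ∀ Q : Finset M, #{x ∈ Q | g x = i} + #{x ∈ Q | g x = j} =
      #{x ∈ Q | f x = i} + #{x ∈ Q | f x = j} := by
    intro Q
    rw [← card_union_of_disjoint (disjoint_filter.2 fun x _ h1 h2 => hij (h1.symm.trans h2)),
      ← card_union_of_disjoint (disjoint_filter.2 fun x _ h1 h2 => hij (h1.symm.trans h2))]
    congr 1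
    ext x
    simp only [mem_union, mem_filter, g]
    grind
  have sq : ∀ φ : M → Fin n, ∀ Q : Finset M, ∑ k, #{x ∈ Q | φ x = k} ^ 2 =
      #{x ∈ Q | φ x = i} ^ 2 + (#{x ∈ Q | φ x = j} ^ 2 +
        ∑ k ∈ (univ.erase i).erase j, #{x ∈ Q | φ x = k} ^ 2) := by
    intro φ Q
    rw [← add_sum_erase _ _ (mem_univ i),
      ← add_sum_erase (univ.erase i) _ (mem_erase.2 ⟨hij.symm, mem_univ j⟩)]
  have rest : ∀ Q : Finset M, ∑ k ∈ (univ.erase i).erase j, #{x ∈ Q | g x = k} ^ 2 =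
      ∑ k ∈ (univ.erase i).erase j, #{x ∈ Q | f x = k} ^ 2 := by
    intro Q
    refine sum_congr rfl fun k hk => ?_
    simp only [mem_erase, mem_univ, and_true] at hk
    rw [other Q k hk.2 hk.1]
  have arith : ∀ a b a' b' : ℕ, a' + b' = a + b → a' ≤ b' + 1 → b' ≤ a' + 1 →
      a' ^ 2 + b' ^ 2 ≤ a ^ 2 + b ^ 2 := by
    intro a b a' b' h1 h2 h3
    zify at h1 h2 h3 ⊢
    obtain h | h | h : (a' : ℤ) = b' ∨ (a' : ℤ) = b' + 1 ∨ (b' : ℤ) = a' + 1 := by omega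
    · nlinarith [sq_nonneg ((b' : ℤ) - b)]
    · rcases le_or_gt (b : ℤ) b' with h' | h' <;> nlinarith
    · rcases le_or_gt (a : ℤ) a' with h' | h' <;> nlinarith
  have arith' : ∀ a b a' b' : ℕ, a' + b' = a + b → a' ≤ b' + 1 → b' ≤ a' + 1 → b + 1 < a →
      a' ^ 2 + b' ^ 2 < a ^ 2 + b ^ 2 := by
    intro a b a' b' h1 h2 h3 h4
    zify at h1 h2 h3 h4 ⊢
    obtain h | h | h : (a' : ℤ) = b' ∨ (a' : ℤ) = b' + 1 ∨ (b' : ℤ) = a' + 1 := by omega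
    · nlinarith
    · nlinarith
    · nlinarith
  refine absurd (hf g) (not_le.2 ?_)
  refine sum_lt_sum (fun Q hQ => ?_) ⟨P, by simpa using hP, ?_⟩
  · have hQ' := hχ Q (by simpa using hQ)
    rw [sq, sq, rest]
    have := arith _ _ _ _ (total Q) (by rw [gi, gj]; exact hQ' true)
      (by rw [gi, gj]; exact hQ' false)
    omega
  · have hQ' := hχ P hP
    rw [sq, sq, rest]
    have := arith' _ _ _ _ (total P) (by rw [gi, gj]; exact hQ' true)
      (by rw [gi, gj]; exact hQ' false) hlt
    omega

/-- Nash-Williams' lemma: some set `A` contains about a fraction `1 / n` of every class of every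
member of two chains of equivalence relations. -/
theorem exists_balanced_finset {M : Type*} [Fintype M] [DecidableEq M] (𝓐 𝓑 : List (Setoid M))
    (h𝓐 : 𝓐.Pairwise (· ≥ ·)) (h𝓑 : 𝓑.Pairwise (· ≥ ·)) (n : ℕ) (hn : 0 < n) :
    ∃ A : Finset M, ∀ r ∈ 𝓐 ++ 𝓑, ∀ P : Finset M, ∀ x, (∀ z, z ∈ P ↔ r z x) →
      #P < n * #(P ∩ A) + n ∧ n * #(P ∩ A) < #P + n := by
  classical
  obtain ⟨f, hf⟩ := (splittable_of_chains 𝓐 𝓑 h𝓐 h𝓑).exists_coloring n hn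
  refine ⟨univ.filter (f · = ⟨0, hn⟩), fun r hr P x hP => ?_⟩
  have hb := hf P ⟨r, hr, x, hP⟩
  have e : P ∩ univ.filter (f · = ⟨0, hn⟩) = ({x ∈ P | f x = ⟨0, hn⟩} : Finset M) := by
    ext; simp
  rw [e]
  have hs : #P = ∑ i, #{x ∈ P | f x = i} := card_eq_sum_card_fiberwise (fun _ _ => mem_coe.2 (mem_univ _))
  set a := #{x ∈ P | f x = ⟨0, hn⟩} with ha
  rw [← add_sum_erase _ _ (mem_univ (⟨0, hn⟩ : Fin n)), ← ha] at hs
  have hc : #(univ.erase (⟨0, hn⟩ : Fin n)) = n - 1 := by simp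
  have h1 : ∑ i ∈ univ.erase (⟨0, hn⟩ : Fin n), #{x ∈ P | f x = i} ≤ (n - 1) * (a + 1) := by
    rw [← hc, ← smul_eq_mul]
    exact sum_le_card_nsmul _ _ _ fun i _ => hb i _
  -- The subtraction `a - 1` is truncated, so the case `a = 0` is treated separately below.
  have h2 : (n - 1) * (a - 1) ≤ ∑ i ∈ univ.erase (⟨0, hn⟩ : Fin n), #{x ∈ P | f x = i} := by
    rw [← hc, ← smul_eq_mul]
    exact card_nsmul_le_sum _ _ _ fun i _ => by have := hb ⟨0, hn⟩ i; omega
  obtain ⟨m, rfl⟩ : ∃ m, n = m + 1 := ⟨n - 1, by omega⟩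
  simp only [Nat.add_sub_cancel] at h1 h2
  constructor
  · nlinarith
  · rcases Nat.eq_zero_or_pos a with h0 | h0
    · rw [h0]; omega
    · obtain ⟨b, hb⟩ : ∃ b, a = b + 1 := ⟨a - 1, by omega⟩
      rw [hb] at hs h2 ⊢
      simp only [Nat.add_sub_cancel] at h2
      nlinarith

end Balance

/-! ### Rounding that survives iteration. -/

section FairShare

/-- `N'` lies between the same integral multiples of `n'` as `N` does of `n`. -/
def FairShare (N n N' n' : ℕ) : Prop :=
  ∀ L : ℕ, (L * n ≤ N → L * n' ≤ N') ∧ (N ≤ L * n → N' ≤ L * n')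

theorem FairShare.refl (N n : ℕ) : FairShare N n N n := fun _ => ⟨id, id⟩

/-- The same integer `L` bounds both stages, so nothing is lost in composition. A relation between
rounded quotients at each stage would lack this property. -/
theorem FairShare.trans {a b c d e f : ℕ} (h : FairShare a b c d) (h' : FairShare c d e f) :
    FairShare a b e f := fun L => ⟨(h' L).1 ∘ (h L).1, (h' L).2 ∘ (h L).2⟩

theorem FairShare.congr {a b c d a' b' c' d' : ℕ} (h : FairShare a b c d) (ha : a' = a)
    (hb : b' = b) (hc : c' = c) (hd : d' = d) : FairShare a' b' c' d' := by
  subst ha hb hc hd; exact h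

/-- Of `P` darts at a vertex of weight `n`, `a` move to the new vertex of weight one. The factor `b`
is the weight at the other end: `1` for degrees, the weight of the neighbor for multiplicities, `n -
1` for loops. -/
theorem fairShare_moved {P n a : ℕ} (b : ℕ) (h1 : P < n * a + n) (h2 : n * a < P + n) :
    FairShare P (n * b) a b := by
  intro L
  constructor <;> intro h
  · by_contra! hlt
    have : n * (a + 1) ≤ n * (L * b) := Nat.mul_le_mul_left _ hlt
    nlinarith
  · by_contra! hlt
    have : n * (L * b + 1) ≤ n * a := Nat.mul_le_mul_left _ hlt
    nlinarith

/-- The counterpart of `fairShare_moved` for the darts that stay. -/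
theorem fairShare_kept {P n a r : ℕ} (b : ℕ) (hn : 0 < n) (h1 : P < n * a + n)
    (h2 : n * a < P + n) (hr : r + a = P) : FairShare P (n * b) r ((n - 1) * b) := by
  obtain ⟨m, rfl⟩ : ∃ m, n = m + 1 := ⟨n - 1, by omega⟩
  subst hr
  intro L
  rw [Nat.add_sub_cancel]
  constructor <;> intro h
  · by_contra! hlt
    have e1 : (m + 1) * (r + 1) ≤ (m + 1) * (L * (m * b)) := Nat.mul_le_mul_left _ hlt
    have e2 : m * (L * ((m + 1) * b)) ≤ m * (r + a) := Nat.mul_le_mul_left _ h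
    nlinarith
  · by_contra! hlt
    have e1 : (m + 1) * (L * (m * b) + 1) ≤ (m + 1) * r := Nat.mul_le_mul_left _ hlt
    have e2 : m * (r + a) ≤ m * (L * ((m + 1) * b)) := Nat.mul_le_mul_left _ h
    nlinarith

/-- Each moved loop takes both its darts out of the loop count, which doubles the error: `r` differs
from `(n - 2) * P / n` by less than two. Since `r` and the multiples of `(n - 1) * (n - 2)` are
even, this is still enough. -/
theorem fairShare_kept_loops {P n a r : ℕ} (hn : 2 ≤ n) (h1 : P < n * a + n)
    (h2 : n * a < P + n) (hr : r + 2 * a = P) (hP : Even P) :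
    FairShare P (n * (n - 1)) r ((n - 1) * (n - 1 - 1)) := by
  obtain ⟨m, rfl⟩ : ∃ m, n = m + 2 := ⟨n - 2, by omega⟩
  obtain ⟨s, rfl⟩ : ∃ s, r = 2 * s := by obtain ⟨x, hx⟩ := hP; exact ⟨x - a, by omega⟩
  subst hr
  intro L
  have e0 : m + 2 - 1 = m + 1 := rfl
  have e0' : m + 1 - 1 = m := rfl
  rw [e0, e0']
  obtain ⟨q, hq⟩ : ∃ q, L * ((m + 1) * m) = 2 * q := by
    obtain ⟨q, hq⟩ := Nat.even_mul_succ_self m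
    exact ⟨L * q, by rw [mul_comm (m + 1) m, hq]; ring⟩
  have hq' : L * ((m + 2) * (m + 1)) * m = 2 * ((m + 2) * q) := by
    calc _ = (m + 2) * (L * ((m + 1) * m)) := by ring
      _ = _ := by rw [hq]; ring
  rw [hq]
  constructor <;> intro h
  · have e2 := Nat.mul_le_mul_right m h
    rw [hq'] at e2
    by_contra! hlt
    have e1 : (m + 2) * (s + 1) ≤ (m + 2) * q := Nat.mul_le_mul_left _ (by omega)
    nlinarith
  · have e2 := Nat.mul_le_mul_right m h
    rw [hq'] at e2
    by_contra! hlt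
    have e1 : (m + 2) * (q + 1) ≤ (m + 2) * s := Nat.mul_le_mul_left _ (by omega)
    nlinarith

end FairShare

/-! ### Weighted graphs described by half-edges. -/

section Darts

open Finset Function

variable {E α γ δ C : Type*}

/-- The other half of the same edge. -/
def dartFlip (d : E × Bool) : E × Bool := (d.1, !d.2)

@[simp] theorem dartFlip_fst (d : E × Bool) : (dartFlip d).1 = d.1 := rfl

@[simp] theorem dartFlip_dartFlip (d : E × Bool) : dartFlip (dartFlip d) = d := by simp [dartFlip]

theorem dartFlip_ne (d : E × Bool) : dartFlip d ≠ d := fun h => by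
  simpa [dartFlip] using congrArg Prod.snd h

theorem even_card_of_dartFlip {S : Finset (E × Bool)} (hS : ∀ d ∈ S, dartFlip d ∈ S) :
    Even #S := by
  have h : #{d ∈ S | d.2 = true} = #{d ∈ S | ¬ d.2 = true} := by
    refine card_bij (fun d _ => dartFlip d) ?_ ?_ ?_
    · intro d hd
      simp only [mem_filter] at hd ⊢
      exact ⟨hS d hd.1, by simp [dartFlip, hd.2]⟩
    · intro d _ d' _ h
      simpa using congrArg dartFlip h
    · intro d hd
      simp only [mem_filter] at hd
      refine ⟨dartFlip d, ?_, by simp⟩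
      simp only [mem_filter]
      exact ⟨hS d hd.1, by simpa [dartFlip] using hd.2⟩
  rw [← card_filter_add_card_filter_not (s := S) (fun d => d.2 = true), ← h]
  exact ⟨_, rfl⟩

open scoped Classical in
/-- The number of darts of edges in `T` that end at `u`, where `p` assigns its end to each dart. -/
noncomputable def dartDeg [Fintype E] (p : E × Bool → γ) (T : Set E) (u : γ) : ℕ :=
  #{d : E × Bool | d.1 ∈ T ∧ p d = u}

open scoped Classical in
/-- The number of darts from `u` to `v` of edges in `T`. -/
noncomputable def dartMult [Fintype E] (p : E × Bool → γ) (T : Set E) (u v : γ) : ℕ :=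
  #{d : E × Bool | d.1 ∈ T ∧ p d = u ∧ p (dartFlip d) = v}

open scoped Classical in
/-- The number of ordered pairs of distinct points, one over `u` and one over `v`, when `κ w` points
lie over `w`. -/
noncomputable def pairWeight (κ : γ → ℕ) (u v : γ) : ℕ := κ u * (κ v - if u = v then 1 else 0)

theorem pairWeight_self (κ : γ → ℕ) (u : γ) : pairWeight κ u u = κ u * (κ u - 1) := by
  simp [pairWeight]

theorem pairWeight_of_ne (κ : γ → ℕ) {u v : γ} (h : u ≠ v) : pairWeight κ u v = κ u * κ v := by
  simp [pairWeight, h]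

theorem pairWeight_comm (κ : γ → ℕ) (u v : γ) : pairWeight κ u v = pairWeight κ v u := by
  by_cases h : u = v
  · rw [h]
  · rw [pairWeight_of_ne κ h, pairWeight_of_ne κ (Ne.symm h), mul_comm]

theorem dartMult_comm [Fintype E] (p : E × Bool → γ) (T : Set E) (u v : γ) :
    dartMult p T u v = dartMult p T v u := by
  classical
  unfold dartMult
  refine card_bij (fun d _ => dartFlip d) ?_ ?_ ?_
  · intro d hd
    simp only [mem_filter, mem_univ, true_and] at hd ⊢
    simpa using ⟨hd.1, hd.2.2, hd.2.1⟩
  · intro d _ d' _ h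
    simpa using congrArg dartFlip h
  · intro d hd
    simp only [mem_filter, mem_univ, true_and] at hd
    exact ⟨dartFlip d, by simpa using ⟨hd.1, hd.2.2, hd.2.1⟩, by simp⟩

theorem even_dartMult_self [Fintype E] (p : E × Bool → γ) (T : Set E) (u : γ) :
    Even (dartMult p T u u) := by
  classical
  refine even_card_of_dartFlip fun d hd => ?_
  simp only [mem_filter, mem_univ, true_and] at hd ⊢
  simpa using ⟨hd.1, hd.2.2, hd.2.1⟩

/-- The set of all edges and the color classes. -/
def colorSets (c : E → C) : Set (Set E) := insert Set.univ (Set.range fun j => {e | c e = j})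

/-- Two darts of color `j` are incident if they belong to one edge or end at one vertex. -/
def DartAdj (p : E × Bool → γ) (c : E → C) (j : C) (d d' : E × Bool) : Prop :=
  c d.1 = j ∧ c d'.1 = j ∧ (d' = dartFlip d ∨ p d = p d')

/-- Splitting the vertices of weighted graph `p, κ` gives `p', κ'`: degrees and multiplicities are
shared fairly, and the color classes of colors in `J` do not fall apart. -/
structure Detaches [Fintype E] (c : E → C) (J : Set C) (p : E × Bool → α) (κ : α → ℕ)
    (p' : E × Bool → γ) (κ' : γ → ℕ) (φ : γ → α) : Prop where
  map : ∀ d, φ (p' d) = p d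
  deg : ∀ T ∈ colorSets c, ∀ u,
    FairShare (dartDeg p T (φ u)) (κ (φ u)) (dartDeg p' T u) (κ' u)
  mult : ∀ T ∈ colorSets c, ∀ u v,
    FairShare (dartMult p T (φ u) (φ v)) (pairWeight κ (φ u) (φ v)) (dartMult p' T u v)
      (pairWeight κ' u v)
  joined : ∀ j ∈ J, ∀ d d', DartAdj p c j d d' → Relation.EqvGen (DartAdj p' c j) d d'

theorem Relation.EqvGen.lift_of_imp {A : Type*} {r s : A → A → Prop}
    (h : ∀ a b, r a b → Relation.EqvGen s a b) {a b : A} (hab : Relation.EqvGen r a b) :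
    Relation.EqvGen s a b := by
  induction hab with
  | rel _ _ h' => exact h _ _ h'
  | refl _ => exact .refl _
  | symm _ _ _ ih => exact ih.symm
  | trans _ _ _ _ _ ih ih' => exact ih.trans _ _ _ ih'

theorem Detaches.trans [Fintype E] {c : E → C} {J : Set C} {p : E × Bool → α} {κ : α → ℕ}
    {p' : E × Bool → γ} {κ' : γ → ℕ} {φ : γ → α} {p'' : E × Bool → δ} {κ'' : δ → ℕ} {φ' : δ → γ}
    (h : Detaches c J p κ p' κ' φ) (h' : Detaches c J p' κ' p'' κ'' φ') :
    Detaches c J p κ p'' κ'' (φ ∘ φ') where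
  map d := by rw [comp_apply, h'.map, h.map]
  deg T hT u := (h.deg T hT (φ' u)).trans (h'.deg T hT u)
  mult T hT u v := (h.mult T hT (φ' u) (φ' v)).trans (h'.mult T hT u v)
  joined j hj d d' hd := Relation.EqvGen.lift_of_imp (h'.joined j hj) (h.joined j hj d d' hd)

end Darts

/-! ### Splitting one vertex off. -/

section Splitting

open Finset Function

variable {E α γ δ C : Type*}

/-- Adjacency of darts of one color, without passing through the vertex `y`. -/
def DartAdjOff (p : E × Bool → γ) (c : E → C) (y : γ) (d d' : E × Bool) : Prop :=
  c d.1 = c d'.1 ∧ (d' = dartFlip d ∨ (p d = p d' ∧ p d ≠ y))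

theorem color_eq_of_eqvGen_dartAdjOff {p : E × Bool → γ} {c : E → C} {y : γ} {d d' : E × Bool}
    (h : Relation.EqvGen (DartAdjOff p c y) d d') : c d.1 = c d'.1 := by
  induction h with
  | rel _ _ h' => exact h'.1
  | refl _ => rfl
  | symm _ _ _ ih => exact ih.symm
  | trans _ _ _ _ _ ih ih' => exact ih.trans ih'

/-- The two halves of a loop at `y` are only joined to each other, away from `y`. -/
theorem eq_or_eq_of_eqvGen_loop {p : E × Bool → γ} {c : E → C} {y : γ} {d d' x : E × Bool}
    (h : Relation.EqvGen (DartAdjOff p c y) d d') (h1 : p x = y) (h2 : p (dartFlip x) = y) :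
    (d = x ∨ d = dartFlip x) ↔ (d' = x ∨ d' = dartFlip x) := by
  induction h with
  | rel a b h' =>
    obtain ⟨-, rfl | ⟨e, ne⟩⟩ := h'
    · constructor
      · rintro (rfl | rfl) <;> simp
      · rintro (h | h)
        · right; rw [← h]; simp
        · left; simpa using congrArg dartFlip h
    · have ne' : p b ≠ y := e ▸ ne
      constructor
      · rintro (rfl | rfl)
        · exact absurd h1 ne
        · exact absurd h2 ne
      · rintro (rfl | rfl)
        · exact absurd h1 ne'
        · exact absurd h2 ne'
  | refl _ => rfl
  | symm _ _ _ ih => exact ih.symm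
  | trans _ _ _ _ _ ih ih' => exact ih.trans ih'

open scoped Classical in
/-- If all degrees in color `j` are even, then every component of color `j` off `y` is joined to
`y` by an even number of edges. -/
theorem even_card_component [Fintype E] {p : E × Bool → γ} {c : E → C} {y : γ} {j : C}
    (hj : ∀ u, Even (dartDeg p {e | c e = j} u)) (d : E × Bool) (hd : c d.1 = j) :
    Even #{z : E × Bool | p z = y ∧ Relation.EqvGen (DartAdjOff p c y) z d} := by
  set Q : Finset (E × Bool) := {z | Relation.EqvGen (DartAdjOff p c y) z d} with hQ
  have hQe : Even #Q := by
    refine even_card_of_dartFlip fun z hz => ?_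
    simp only [hQ, mem_filter, mem_univ, true_and] at hz ⊢
    exact .trans _ _ _ (.symm _ _ (.rel z (dartFlip z) ⟨rfl, .inl rfl⟩)) hz
  have hsplit : #Q = #{z ∈ Q | p z = y} + #{z ∈ Q | p z ≠ y} :=
    (card_filter_add_card_filter_not _).symm
  -- A handshake argument: the component is closed under `dartFlip`, hence even, and away from `y`
  -- it contains all darts of its color at each vertex that it meets.
  have hoff : Even #{z ∈ Q | p z ≠ y} := by
    rw [card_eq_sum_card_image p]
    refine even_sum _ fun u hu => ?_
    obtain ⟨x, hx, rfl⟩ := mem_image.1 hu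
    simp only [hQ, mem_filter, mem_univ, true_and] at hx
    suffices h : #{z ∈ {z ∈ Q | p z ≠ y} | p z = p x} = dartDeg p {e | c e = j} (p x) by
      rw [h]; exact hj _
    unfold dartDeg
    congr 1
    ext z
    simp only [hQ, mem_filter, mem_univ, true_and, Set.mem_ofPred_eq]
    constructor
    · rintro ⟨⟨h1, h2⟩, h3⟩
      exact ⟨(color_eq_of_eqvGen_dartAdjOff h1).trans hd, h3⟩
    · rintro ⟨h1, h2⟩
      refine ⟨⟨.trans _ _ _ (.rel _ _ ⟨?_, .inr ⟨h2, h2 ▸ hx.2⟩⟩) hx.1, h2 ▸ hx.2⟩, h2⟩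
      rw [h1, color_eq_of_eqvGen_dartAdjOff hx.1, hd]
  have : #{z : E × Bool | p z = y ∧ Relation.EqvGen (DartAdjOff p c y) z d} =
      #{z ∈ Q | p z = y} := by
    congr 1; ext z; simp [hQ, and_comm]
  rw [hsplit, Nat.even_add] at hQe
  rw [this]
  exact hQe.2 hoff

open scoped Classical in
/-- Every vertex has a set `A` of darts such that about `1 / n` of its darts in every color, to every
vertex, and to every component of a color class off the vertex are in `A`. -/
theorem exists_balanced_darts [Fintype E] (c : E → C) (p : E × Bool → γ) (y : γ) (n : ℕ)
    (hn : 0 < n) :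
    ∃ A : Finset (E × Bool), ∀ Q : E × Bool → Prop,
      ((∃ T ∈ colorSets c, Q = fun d => d.1 ∈ T) ∨
       (∃ T ∈ colorSets c, ∃ z, Q = fun d => d.1 ∈ T ∧ p (dartFlip d) = z) ∨
       (∃ x, Q = fun d => Relation.EqvGen (DartAdjOff p c y) d x)) →
      #{d | p d = y ∧ Q d} < n * #{d | (p d = y ∧ Q d) ∧ d ∈ A} + n ∧
      n * #{d | (p d = y ∧ Q d) ∧ d ∈ A} < #{d | p d = y ∧ Q d} + n := by
  let s : Setoid (E × Bool) := Relation.EqvGen.setoid (DartAdjOff p c y)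
  -- The first chain refines by vertex, color, component off `y`; the second by pair of ends, then
  -- color. Components are monochromatic, which makes the first a chain.
  let r1 : Setoid (E × Bool) := Setoid.ker p
  let r2 : Setoid (E × Bool) := Setoid.ker fun d => (p d, c d.1)
  let r3 : Setoid (E × Bool) := r1 ⊓ s
  let q1 : Setoid (E × Bool) := Setoid.ker fun d => (p d, p (dartFlip d))
  let q2 : Setoid (E × Bool) := Setoid.ker fun d => (p d, p (dartFlip d), c d.1)
  have m2 : ∀ a b, r2 a b ↔ p a = p b ∧ c a.1 = c b.1 := fun _ _ => Prod.mk_inj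
  have m3 : ∀ a b, r3 a b ↔ p a = p b ∧ Relation.EqvGen (DartAdjOff p c y) a b :=
    fun _ _ => Iff.rfl
  have m4 : ∀ a b, q1 a b ↔ p a = p b ∧ p (dartFlip a) = p (dartFlip b) := fun _ _ => Prod.mk_inj
  have m5 : ∀ a b, q2 a b ↔ p a = p b ∧ p (dartFlip a) = p (dartFlip b) ∧ c a.1 = c b.1 :=
    fun _ _ => Prod.mk_inj.trans (and_congr_right fun _ => Prod.mk_inj)
  have l21 : r2 ≤ r1 := fun a b h => ((m2 a b).1 h).1
  have l31 : r3 ≤ r1 := inf_le_left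
  have l32 : r3 ≤ r2 := fun a b h =>
    (m2 a b).2 ⟨((m3 a b).1 h).1, color_eq_of_eqvGen_dartAdjOff ((m3 a b).1 h).2⟩
  have l' : q2 ≤ q1 := fun a b h => (m4 a b).2 ⟨((m5 a b).1 h).1, ((m5 a b).1 h).2.1⟩
  obtain ⟨A, hA⟩ := exists_balanced_finset [r1, r2, r3] [q1, q2] (by simp [l21, l31, l32])
    (by simp [l']) n hn
  have bal : ∀ Q : E × Bool → Prop,
      (∃ r ∈ [r1, r2, r3] ++ [q1, q2], ∀ x, p x = y → Q x → ∀ z, (p z = y ∧ Q z) ↔ r z x) →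
      #{d | p d = y ∧ Q d} < n * #{d | (p d = y ∧ Q d) ∧ d ∈ A} + n ∧
      n * #{d | (p d = y ∧ Q d) ∧ d ∈ A} < #{d | p d = y ∧ Q d} + n := by
    rintro Q ⟨r, hr, h⟩
    have e : ({d | (p d = y ∧ Q d) ∧ d ∈ A} : Finset (E × Bool)) =
        ({d | p d = y ∧ Q d} : Finset (E × Bool)) ∩ A := by
      ext; simp
    rw [e]
    rcases Finset.eq_empty_or_nonempty ({d | p d = y ∧ Q d} : Finset (E × Bool)) with h0 | ⟨x, hx⟩
    · simp [h0, hn]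
    · simp only [mem_filter, mem_univ, true_and] at hx
      exact hA r hr _ x fun z => by simp only [mem_filter, mem_univ, true_and]; exact h x hx.1 hx.2 z
  refine ⟨A, fun Q hQ => bal Q ?_⟩
  rcases hQ with ⟨T, rfl | ⟨j, rfl⟩, rfl⟩ | ⟨T, rfl | ⟨j, rfl⟩, z, rfl⟩ | ⟨x, rfl⟩
  · exact ⟨r1, by simp, fun x hx _ z => by simp [hx]⟩
  · exact ⟨r2, by simp, fun x hx hx' z => by
      simp only [Set.mem_ofPred_eq] at hx'
      simp [hx, hx']⟩
  · exact ⟨q1, by simp, fun x hx hx' z => by simp [hx, hx'.2]⟩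
  · exact ⟨q2, by simp, fun x hx hx' z => by
      simp only [Set.mem_ofPred_eq] at hx'
      simp [hx, hx'.1, hx'.2, and_comm]⟩
  · exact ⟨r3, by simp, fun x' hx hx' z => by
      rw [m3, hx]
      exact and_congr_right fun _ => ⟨fun h => h.trans _ _ _ hx'.symm, fun h => h.trans _ _ _ hx'⟩⟩

/-- A vertex `y` of weight at least two can be split into `y` and a new vertex `v` of weight one. -/
theorem exists_splitting [Fintype E] (c : E → C) (J : Set C) (p : E × Bool → γ) (κ κ' : γ → ℕ)
    (y v : γ) (hy : 2 ≤ κ y) (hvy : v ≠ y) (hpv : ∀ d, p d ≠ v) (hκy : κ' y = κ y - 1)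
    (hκv : κ' v = 1) (hκ : ∀ u, u ≠ y → u ≠ v → κ' u = κ u) (φ : γ → γ) (hφv : φ v = y)
    (hφ : ∀ u, u ≠ v → φ u = u) (hJ : ∀ j ∈ J, ∀ u, Even (dartDeg p {e | c e = j} u)) :
    ∃ p', Detaches c J p κ p' κ' φ := by
  classical
  obtain ⟨A, hA⟩ := exists_balanced_darts c p y (κ y) (by omega)
  let p' : E × Bool → γ := fun d => if p d = y ∧ d ∈ A then v else p d
  have pv : ∀ d, p' d = v ↔ p d = y ∧ d ∈ A := fun d => by
    by_cases h : p d = y ∧ d ∈ A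
    · simp [p', h]
    · simp only [p', h, if_false, iff_false]; exact hpv d
  have py : ∀ d, p' d = y ↔ p d = y ∧ d ∉ A := fun d => by
    by_cases h : p d = y ∧ d ∈ A
    · simp [p', h, hvy]
    · simp only [p', h, if_false]; tauto
  have po : ∀ d u, u ≠ y → u ≠ v → (p' d = u ↔ p d = u) := fun d u h1 h2 => by
    by_cases h : p d = y ∧ d ∈ A
    · simp only [p', h, and_self, if_true]
      exact ⟨fun e => absurd e.symm h2, fun e => absurd e.symm h1⟩
    · simp only [p', h, if_false]
  have pyv : ∀ d, p d = y ↔ p' d = y ∨ p' d = v := fun d => by rw [py, pv]; tauto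
  have p'e : ∀ d, p d ≠ y → p' d = p d := fun d h => by simp [p', h]
  -- The two darts of a loop at `y` form a whole component off `y`. Moving both would require `2 * κ
  -- y < 2 + κ y`, against `2 ≤ κ y`; so `v` receives no loops.
  have noloop : ∀ d, p d = y → p (dartFlip d) = y → d ∈ A → dartFlip d ∉ A := by
    intro d h1 h2 h3 h4
    have h5 := (hA _ (.inr (.inr ⟨d, rfl⟩))).2
    have e1 : ({z | p z = y ∧ Relation.EqvGen (DartAdjOff p c y) z d} : Finset (E × Bool)) =
        {d, dartFlip d} := by
      ext z
      simp only [mem_filter, mem_univ, true_and, mem_insert, mem_singleton]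
      constructor
      · rintro ⟨-, h⟩
        exact (eq_or_eq_of_eqvGen_loop h h1 h2).2 (.inl rfl)
      · rintro (rfl | rfl)
        · exact ⟨h1, .refl _⟩
        · exact ⟨h2, .symm _ _ (.rel _ _ ⟨rfl, .inl rfl⟩)⟩
    have e2 : ({z | (p z = y ∧ Relation.EqvGen (DartAdjOff p c y) z d) ∧ z ∈ A} :
        Finset (E × Bool)) = {d, dartFlip d} := by
      rw [← filter_filter, e1]
      refine filter_true_of_mem ?_
      simp [h3, h4]
    rw [e1, e2, card_pair (dartFlip_ne d).symm] at h5
    omega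
  refine ⟨p', fun d => ?_, fun T hT u => ?_, fun T hT u w => ?_, fun j hj d d' hd => ?_⟩
  · by_cases h : p d = y ∧ d ∈ A
    · rw [(pv d).2 h, hφv, h.1]
    · have : p' d = p d := by simp [p', h]
      rw [this, hφ _ (hpv d)]
  · have hb := hA _ (.inl ⟨T, hT, rfl⟩)
    have ev : dartDeg p' T v = #{d : E × Bool | (p d = y ∧ d.1 ∈ T) ∧ d ∈ A} := by
      unfold dartDeg; congr 1; ext d; simp [pv]; tauto
    have ey : dartDeg p T y = #{d : E × Bool | p d = y ∧ d.1 ∈ T} := by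
      unfold dartDeg; congr 1; ext d; simp [and_comm]
    have es : dartDeg p' T y + dartDeg p' T v = dartDeg p T y := by
      unfold dartDeg
      rw [← card_union_of_disjoint (disjoint_filter.2 fun d _ h1 h2 => hvy (h2.2.symm.trans h1.2))]
      congr 1; ext d; simp only [mem_union, mem_filter, mem_univ, true_and, pyv d]; tauto
    rw [← ey, ← ev] at hb
    by_cases huv : u = v
    · subst huv
      rw [hφv, hκv]
      exact (fairShare_moved 1 hb.1 hb.2).congr rfl (by ring) rfl rfl
    rw [hφ u huv]
    by_cases huy : u = y
    · subst huy
      rw [hκy]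
      exact (fairShare_kept 1 (by omega) hb.1 hb.2 es).congr rfl (by ring) rfl (by ring)
    rw [hκ u huy huv]
    have : dartDeg p' T u = dartDeg p T u := by
      unfold dartDeg; congr 1; ext d; simp [po d u huy huv]
    rw [this]
    exact .refl _ _
  · have one : ∀ z, z ≠ y → z ≠ v →
        FairShare (dartMult p T y z) (pairWeight κ y z) (dartMult p' T v z) (pairWeight κ' v z) ∧
        FairShare (dartMult p T y z) (pairWeight κ y z) (dartMult p' T y z) (pairWeight κ' y z) := by
      intro z hzy hzv
      have hb := hA _ (.inr (.inl ⟨T, hT, z, rfl⟩))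
      have ev : dartMult p' T v z =
          #{d : E × Bool | (p d = y ∧ d.1 ∈ T ∧ p (dartFlip d) = z) ∧ d ∈ A} := by
        unfold dartMult; congr 1; ext d; simp [pv, po _ z hzy hzv]; tauto
      have ey : dartMult p T y z = #{d : E × Bool | p d = y ∧ d.1 ∈ T ∧ p (dartFlip d) = z} := by
        unfold dartMult; congr 1; ext d; simp; tauto
      have es : dartMult p' T y z + dartMult p' T v z = dartMult p T y z := by
        unfold dartMult
        rw [← card_union_of_disjoint
          (disjoint_filter.2 fun d _ h1 h2 => hvy (h2.2.1.symm.trans h1.2.1))]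
        congr 1; ext d
        simp only [mem_union, mem_filter, mem_univ, true_and, pyv d, po _ z hzy hzv]; tauto
      have hb : dartMult p T y z < κ y * dartMult p' T v z + κ y ∧
          κ y * dartMult p' T v z < dartMult p T y z + κ y := by
        rw [ey, ev]; convert hb
      rw [pairWeight_of_ne κ hzy.symm, pairWeight_of_ne κ' hzv.symm, pairWeight_of_ne κ' hzy.symm,
        hκv, hκy, hκ z hzy hzv, one_mul]
      exact ⟨fairShare_moved _ hb.1 hb.2, fairShare_kept _ (by omega) hb.1 hb.2 es⟩
    have hb := hA _ (.inr (.inl ⟨T, hT, y, rfl⟩))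
    have evy : dartMult p' T v y =
        #{d : E × Bool | (p d = y ∧ d.1 ∈ T ∧ p (dartFlip d) = y) ∧ d ∈ A} := by
      unfold dartMult; congr 1; ext d
      have := noloop d
      simp only [pv, py, mem_filter, mem_univ, true_and]
      tauto
    have eyy : dartMult p T y y = #{d : E × Bool | p d = y ∧ d.1 ∈ T ∧ p (dartFlip d) = y} := by
      unfold dartMult; congr 1; ext d; simp; tauto
    have evv : dartMult p' T v v = 0 := by
      unfold dartMult
      rw [card_eq_zero, filter_eq_empty_iff]
      rintro d - ⟨-, h1, h2⟩
      rw [pv] at h1 h2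
      exact noloop d h1.1 h2.1 h1.2 h2.2
    -- A loop with one moved dart becomes an edge between `y` and `v`, so both its darts leave the
    -- loop count.
    have es : dartMult p' T y y + 2 * dartMult p' T v y = dartMult p T y y := by
      have h2 : 2 * dartMult p' T v y = dartMult p' T v y + dartMult p' T y v := by
        rw [dartMult_comm p' T y v, two_mul]
      rw [h2]
      unfold dartMult
      rw [← card_union_of_disjoint, ← card_union_of_disjoint]
      · congr 1; ext d
        have h1 := noloop d
        simp only [mem_union, mem_filter, mem_univ, true_and, pv, py]; tauto
      · rw [disjoint_union_right]
        constructor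
        · exact disjoint_filter.2 fun d _ h1 h2 => hvy (h2.2.1.symm.trans h1.2.1)
        · exact disjoint_filter.2 fun d _ h1 h2 => hvy (h2.2.2.symm.trans h1.2.2)
      · exact disjoint_filter.2 fun d _ h1 h2 => hvy (h1.2.1.symm.trans h2.2.1)
    have hb : dartMult p T y y < κ y * dartMult p' T v y + κ y ∧
        κ y * dartMult p' T v y < dartMult p T y y + κ y := by
      rw [eyy, evy]; convert hb
    have loops : FairShare (dartMult p T y y) (pairWeight κ y y) (dartMult p' T v y)
        (pairWeight κ' v y) := by
      rw [pairWeight_self, pairWeight_of_ne κ' hvy, hκv, hκy, one_mul]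
      exact fairShare_moved _ hb.1 hb.2
    by_cases huv : u = v
    · rw [huv, hφv]
      by_cases hwv : w = v
      · rw [hwv, hφv, evv, pairWeight_self κ', hκv]
        exact fun L => ⟨fun _ => by simp, fun _ => by simp⟩
      rw [hφ w hwv]
      by_cases hwy : w = y
      · rw [hwy]; exact loops
      exact (one w hwy hwv).1
    rw [hφ u huv]
    by_cases huy : u = y
    · rw [huy]
      by_cases hwv : w = v
      · rw [hwv, hφv, dartMult_comm p', pairWeight_comm κ']; exact loops
      rw [hφ w hwv]
      by_cases hwy : w = y
      · rw [hwy, pairWeight_self, pairWeight_self, hκy]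
        exact fairShare_kept_loops hy hb.1 hb.2 es (even_dartMult_self _ _ _)
      exact (one w hwy hwv).2
    by_cases hwv : w = v
    · rw [hwv, hφv, dartMult_comm p', pairWeight_comm κ', dartMult_comm p, pairWeight_comm κ]
      exact (one u huy huv).1
    rw [hφ w hwv]
    by_cases hwy : w = y
    · rw [hwy, dartMult_comm p', pairWeight_comm κ', dartMult_comm p, pairWeight_comm κ]
      exact (one u huy huv).2
    have e1 : dartMult p' T u w = dartMult p T u w := by
      unfold dartMult; congr 1; ext d; simp [po _ u huy huv, po _ w hwy hwv]
    have e2 : pairWeight κ' u w = pairWeight κ u w := by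
      simp only [pairWeight, hκ u huy huv, hκ w hwy hwv]
    rw [e1, e2]
    exact .refl _ _
  · have off : ∀ a b, c a.1 = j → Relation.EqvGen (DartAdjOff p c y) a b →
        Relation.EqvGen (DartAdj p' c j) a b := by
      intro a b ha hab
      induction hab with
      | rel a b h =>
        refine .rel _ _ ⟨ha, h.1 ▸ ha, h.2.imp_right fun h' => ?_⟩
        rw [p'e a h'.2, p'e b (h'.1 ▸ h'.2), h'.1]
      | refl _ => exact .refl _
      | symm a b h ih => exact .symm _ _ (ih ((color_eq_of_eqvGen_dartAdjOff h).trans ha))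
      | trans a b e h1 _ ih1 ih2 =>
        exact .trans _ _ _ (ih1 ha) (ih2 ((color_eq_of_eqvGen_dartAdjOff h1).symm.trans ha))
    -- The component of `a` off `y` has `2 * m ≥ 2` darts at `y`. Were all of them in `A`, balance
    -- would give `κ y * (2 * m) < 2 * m + κ y`, impossible for `κ y ≥ 2`. So some dart `h` of it
    -- stays at `y` and links `a` to `b`.
    have bridge : ∀ a, p a = y → a ∈ A → c a.1 = j → ∀ b, p b = y → b ∉ A → c b.1 = j →
        Relation.EqvGen (DartAdj p' c j) a b := by
      intro a hay haA haj b hby hbA hbj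
      have h5 : κ y * #{z | (p z = y ∧ Relation.EqvGen (DartAdjOff p c y) z a) ∧ z ∈ A} <
          #{z | p z = y ∧ Relation.EqvGen (DartAdjOff p c y) z a} + κ y := by
        convert (hA _ (.inr (.inr ⟨a, rfl⟩))).2
      obtain ⟨m, hm⟩ := even_card_component (y := y) (hJ j hj) a haj
      obtain ⟨h, hh, hhA⟩ : ∃ h, (p h = y ∧ Relation.EqvGen (DartAdjOff p c y) h a) ∧ h ∉ A := by
        by_contra! hall
        have e : #{z | (p z = y ∧ Relation.EqvGen (DartAdjOff p c y) z a) ∧ z ∈ A} =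
            #{z | p z = y ∧ Relation.EqvGen (DartAdjOff p c y) z a} :=
          congrArg _ (filter_congr fun z _ => ⟨fun h => h.1, fun h => ⟨h, hall z h⟩⟩)
        rw [e, hm] at h5
        have hpos : 0 < #{z | p z = y ∧ Relation.EqvGen (DartAdjOff p c y) z a} :=
          card_pos.2 ⟨a, by simp [hay, Relation.EqvGen.refl]⟩
        rw [hm] at hpos
        obtain ⟨m', rfl⟩ : ∃ m', m = m' + 1 := ⟨m - 1, by omega⟩
        obtain ⟨q, hq⟩ : ∃ q, κ y = q + 2 := ⟨κ y - 2, by omega⟩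
        rw [hq] at h5
        nlinarith
      have hc := color_eq_of_eqvGen_dartAdjOff hh.2
      refine .trans _ _ _ (off a h haj hh.2.symm) (.rel _ _ ⟨hc.trans haj, hbj, .inr ?_⟩)
      rw [(py h).2 ⟨hh.1, hhA⟩, (py b).2 ⟨hby, hbA⟩]
    obtain ⟨h1, h2, h3 | h3⟩ := hd
    · exact .rel _ _ ⟨h1, h2, .inl h3⟩
    · by_cases h4 : p d = y
      · have h4' : p d' = y := h3 ▸ h4
        by_cases h5 : d ∈ A <;> by_cases h6 : d' ∈ A
        · exact .rel _ _ ⟨h1, h2, .inr (by rw [(pv d).2 ⟨h4, h5⟩, (pv d').2 ⟨h4', h6⟩])⟩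
        · exact bridge d h4 h5 h1 d' h4' h6 h2
        · exact .symm _ _ (bridge d' h4' h6 h2 d h4 h5 h1)
        · exact .rel _ _ ⟨h1, h2, .inr (by rw [(py d).2 ⟨h4, h5⟩, (py d').2 ⟨h4', h6⟩])⟩
      · exact .rel _ _ ⟨h1, h2, .inr (by rw [p'e d h4, p'e d' (h3 ▸ h4), h3])⟩

end Splitting

/-! ### Repeating the splitting until all weights are one. -/

section Iterate

open Finset Function

variable {E α γ C : Type*}

theorem fairShare_zero_zero (N n : ℕ) : FairShare N n 0 0 := fun _ => ⟨by simp, by simp⟩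

theorem pairWeight_eq_zero {κ : γ → ℕ} {u : γ} (h : κ u = 0) (v : γ) : pairWeight κ u v = 0 := by
  simp [pairWeight, h]

theorem dartDeg_eq_zero [Fintype E] {p : E × Bool → γ} {u : γ} (h : ∀ d, p d ≠ u) (T : Set E) :
    dartDeg p T u = 0 := by
  classical
  unfold dartDeg
  rw [card_eq_zero, filter_eq_empty_iff]
  exact fun d _ hd => h d hd.2

theorem dartMult_eq_zero [Fintype E] {p : E × Bool → γ} {u : γ} (h : ∀ d, p d ≠ u) (T : Set E)
    (v : γ) : dartMult p T u v = 0 := by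
  classical
  unfold dartMult
  rw [card_eq_zero, filter_eq_empty_iff]
  exact fun d _ hd => h d hd.2.1

/-- A fair share of weight zero is zero once the original weight is positive. This shows that
vertices not yet created carry no darts. -/
theorem Detaches.ne_of_weight_eq_zero [Fintype E] {c : E → C} {J : Set C} {p : E × Bool → α}
    {κ : α → ℕ} {p' : E × Bool → γ} {κ' : γ → ℕ} {φ : γ → α} (h : Detaches c J p κ p' κ' φ) {u : γ}
    (h1 : κ' u = 0) (h2 : 0 < κ (φ u)) (d : E × Bool) : p' d ≠ u := by
  classical
  intro hd
  have h3 := (h.deg Set.univ (.inl rfl) u (dartDeg p Set.univ (φ u))).2 (Nat.le_mul_of_pos_right _ h2)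
  rw [h1, mul_zero, Nat.le_zero] at h3
  unfold dartDeg at h3
  refine notMem_empty d ?_
  rw [← card_eq_zero.1 h3]
  simp [hd]

open scoped Classical in
/-- The weights when `s w` of the `η w` parts of `w` still coincide, in the vertex `(w, 0)`. -/
noncomputable def partialWeight (V : Set α) (η s : α → ℕ) (u : α × ℕ) : ℕ :=
  if u.1 ∈ V then if u.2 = 0 then s u.1 else if s u.1 ≤ u.2 ∧ u.2 < η u.1 then 1 else 0 else 0

theorem detaches_base [Fintype E] (c : E → C) (J : Set C) (V : Set α) (η : α → ℕ)
    (p : E × Bool → α) (hp : ∀ d, p d ∈ V) :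
    Detaches c J p η (fun d => (p d, 0)) (partialWeight V η η) Prod.fst := by
  classical
  have hz : ∀ u : α × ℕ, ¬ (u.1 ∈ V ∧ u.2 = 0) → partialWeight V η η u = 0 ∧
      ∀ d, (p d, 0) ≠ u := by
    rintro ⟨w, i⟩ h
    constructor
    · simp only [partialWeight]
      simp only at h
      split_ifs <;> first | rfl | tauto | omega
    · rintro d hd
      obtain ⟨rfl, rfl⟩ := Prod.mk.inj hd
      exact h ⟨hp d, rfl⟩
  have hw : ∀ w ∈ V, partialWeight V η η (w, 0) = η w := fun w hw => by simp [partialWeight, hw]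
  refine ⟨fun _ => rfl, fun T _ u => ?_, fun T _ u v => ?_, fun j _ d d' h => ?_⟩
  · by_cases hu : u.1 ∈ V ∧ u.2 = 0
    · obtain ⟨w, i⟩ := u
      obtain ⟨hwV, rfl⟩ := hu
      rw [hw w hwV]
      refine (FairShare.refl _ _).congr rfl rfl ?_ rfl
      simp [dartDeg]
    · rw [(hz u hu).1, dartDeg_eq_zero (hz u hu).2]
      exact fairShare_zero_zero _ _
  · by_cases hu : u.1 ∈ V ∧ u.2 = 0
    · by_cases hv : v.1 ∈ V ∧ v.2 = 0
      · obtain ⟨w, i⟩ := u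
        obtain ⟨hwV, rfl⟩ := hu
        obtain ⟨z, i⟩ := v
        obtain ⟨hzV, rfl⟩ := hv
        refine (FairShare.refl _ _).congr rfl rfl ?_ ?_
        · simp [dartMult]
        · simp [pairWeight, hw w hwV, hw z hzV]
      · rw [dartMult_comm (fun d => (p d, 0)), dartMult_eq_zero (hz v hv).2,
          pairWeight_comm (partialWeight V η η), pairWeight_eq_zero (hz v hv).1]
        exact fairShare_zero_zero _ _
    · rw [dartMult_eq_zero (hz u hu).2, pairWeight_eq_zero (hz u hu).1]
      exact fairShare_zero_zero _ _
  · exact .rel _ _ ⟨h.1, h.2.1, h.2.2.imp_right fun h => by simp only [h]⟩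

open scoped Classical in
/-- Every vertex `w` can be split completely, into `η w` vertices of weight one. -/
theorem exists_detaches [Fintype E] (c : E → C) (J : Set C) (V : Finset α) (η : α → ℕ)
    (hη : ∀ w ∈ V, 0 < η w) (p₀ : E × Bool → α) (hp : ∀ d, p₀ d ∈ V)
    (hJ : ∀ j ∈ J, ∀ w, ∃ m, dartDeg p₀ {e | c e = j} w = 2 * m * η w) :
    ∃ p : E × Bool → α × ℕ, Detaches c J p₀ η p
      (fun u => if u.1 ∈ V ∧ u.2 < η u.1 then 1 else 0) Prod.fst := by
  -- Each split lowers one `s w` by one, so the total of `s` serves for induction.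
  suffices H : ∀ (N : ℕ) (s : α → ℕ) (p : E × Bool → α × ℕ), ∑ w ∈ V, s w = N →
      (∀ w ∈ V, 0 < s w) → (∀ w ∈ V, s w ≤ η w) →
      Detaches c J p₀ η p (partialWeight V η s) Prod.fst →
      ∃ p : E × Bool → α × ℕ, Detaches c J p₀ η p
        (fun u => if u.1 ∈ V ∧ u.2 < η u.1 then 1 else 0) Prod.fst from
    H _ η _ rfl hη (fun _ _ => le_rfl) (detaches_base c J V η p₀ hp)
  intro N
  induction N using Nat.strong_induction_on with
  | _ N ih =>
  intro s p hN hs hsη h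
  by_cases hall : ∀ w ∈ V, s w = 1
  · refine ⟨p, ?_⟩
    convert h using 2 with u
    by_cases hu : u.1 ∈ V
    · have h1 := hall _ hu
      have h2 := hη _ hu
      simp only [partialWeight, mem_coe, hu, true_and, if_true, h1]
      split_ifs <;> omega
    · simp [partialWeight, hu]
  push Not at hall
  obtain ⟨w, hw, hw1⟩ := hall
  have hw2 : 2 ≤ s w := by have := hs w hw; omega
  have hwη := hsη w hw
  have hvy : ((w, s w - 1) : α × ℕ) ≠ (w, 0) := fun e => by
    have := (Prod.mk.inj e).2; omega
  have hκv : partialWeight V η s (w, s w - 1) = 0 := by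
    simp only [partialWeight]
    rw [if_pos (mem_coe.2 hw), if_neg (by omega), if_neg (by omega)]
  -- The parts of `w` are created from the highest index down; `(w, s w - 1)` is the next one and is
  -- still unused.
  obtain ⟨p', hp'⟩ := exists_splitting c J p (partialWeight V η s)
    (partialWeight V η (update s w (s w - 1))) (w, 0) (w, s w - 1)
    (by simpa [partialWeight, hw] using hw2) hvy
    (fun d => h.ne_of_weight_eq_zero hκv (hη w hw) d)
    (by simp [partialWeight, hw])
    (by
      simp only [partialWeight, update_self]
      rw [if_pos (mem_coe.2 hw), if_neg (by omega), if_pos (by omega)])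
    (by
      rintro ⟨z, i⟩ h1 h2
      by_cases hz : z = w
      · subst hz
        have h1' : i ≠ 0 := fun e => h1 (by rw [e])
        have h2' : i ≠ s z - 1 := fun e => h2 (by rw [e])
        simp only [partialWeight, update_self, h1', if_false]
        split_ifs <;> omega
      · simp [partialWeight, update_of_ne hz])
    (fun u => if u = (w, s w - 1) then (w, 0) else u) (by simp) (fun u hu => by simp [hu])
    (by
      intro j hj u
      obtain ⟨m, hm⟩ := hJ j hj u.1
      -- The original degree is exactly `2 * m` times the weight, so both bounds at `L = 2 * m`
      -- apply and the present degree is even too.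
      have h1 := h.deg _ (.inr ⟨j, rfl⟩) u (2 * m)
      rw [hm] at h1
      rw [le_antisymm (h1.2 le_rfl) (h1.1 le_rfl), mul_assoc]
      exact even_two_mul _)
  refine ih _ ?_ (update s w (s w - 1)) p' rfl ?_ ?_ ?_
  · rw [← hN]
    refine sum_lt_sum (fun z _ => ?_) ⟨w, hw, ?_⟩
    · by_cases hz : z = w
      · subst hz; simp
      · simp [update_of_ne hz]
    · simp only [update_self]; omega
  · intro z hz
    by_cases hzw : z = w
    · subst hzw; simp only [update_self]; omega
    · simpa [update_of_ne hzw] using hs z hz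
  · intro z hz
    by_cases hzw : z = w
    · subst hzw; simp only [update_self]; omega
    · simpa [update_of_ne hzw] using hsη z hz
  · convert h.trans hp' using 1
    funext u
    simp only [comp_apply]
    split_ifs with e
    · rw [e]
    · rfl

end Iterate

/-! ### Degrees, multiplicities and components in terms of darts. -/

namespace Graph

open Finset Function

variable {E α β γ δ C : Type*}

/-- The edges of `G` are the images under `ι` of the members of `T`, and `p` gives the ends of their
darts. -/
structure DartEnds (G : Graph γ δ) (ι : E → δ) (T : Set E) (p : E × Bool → γ) : Prop where
  injective : Injective ι
  edgeSet_eq : E(G) = ι '' T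
  isLink : ∀ d : E × Bool, d.1 ∈ T → G.IsLink (ι d.1) (p d) (p (dartFlip d))

theorem eq_or_eq_dartFlip {d d' : E × Bool} (h : d.1 = d'.1) : d' = d ∨ d' = dartFlip d := by
  obtain ⟨e, b⟩ := d
  obtain ⟨e', b'⟩ := d'
  obtain rfl : e = e' := h
  cases b <;> cases b' <;> simp [dartFlip]

theorem DartEnds.isLink_iff {G : Graph γ δ} {ι : E → δ} {T : Set E} {p : E × Bool → γ}
    (h : G.DartEnds ι T p) {e : δ} {x y : γ} :
    G.IsLink e x y ↔ ∃ d : E × Bool, d.1 ∈ T ∧ ι d.1 = e ∧ p d = x ∧ p (dartFlip d) = y := by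
  constructor
  · intro hl
    have he := hl.edge_mem
    rw [h.edgeSet_eq] at he
    obtain ⟨e, heT, rfl⟩ := he
    have := h.isLink (e, false) heT
    rcases hl.eq_and_eq_or_eq_and_eq this with ⟨rfl, rfl⟩ | ⟨rfl, rfl⟩
    · exact ⟨(e, false), heT, rfl, rfl, rfl⟩
    · exact ⟨dartFlip (e, false), heT, rfl, rfl, by simp⟩
  · rintro ⟨d, hd, rfl, rfl, rfl⟩
    exact h.isLink d hd

/-- For distinct ends exactly one dart of each edge runs from `x` to `y`. For a loop both do, whence
the factor two in `two_mul_numLoops_eq`. -/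
theorem DartEnds.mult_eq [Fintype E] {G : Graph γ δ} {ι : E → δ} {T : Set E} {p : E × Bool → γ}
    (h : G.DartEnds ι T p) {x y : γ} (hxy : x ≠ y) : G.mult x y = dartMult p T x y := by
  classical
  unfold mult dartMult
  rw [← card_image_of_injOn (f := fun d : E × Bool => ι d.1), ← Set.ncard_coe_finset]
  · congr 1
    ext e
    simp only [Set.mem_ofPred_eq, h.isLink_iff, coe_image, Set.mem_image, mem_coe, mem_filter,
      mem_univ, true_and]
    exact exists_congr fun d => by tauto
  · intro d hd d' hd' he
    simp only [mem_coe, mem_filter, mem_univ, true_and] at hd hd'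
    rcases eq_or_eq_dartFlip (h.injective he) with e | e
    · exact e.symm
    · rw [e] at hd'
      exact absurd (hd'.2.1.symm.trans hd.2.2) hxy

theorem DartEnds.two_mul_numLoops_eq [Fintype E] {G : Graph γ δ} {ι : E → δ} {T : Set E}
    {p : E × Bool → γ} (h : G.DartEnds ι T p) (x : γ) : 2 * G.numLoops x = dartMult p T x x := by
  classical
  have h1 : G.numLoops x = #{e : E | e ∈ T ∧ p (e, false) = x ∧ p (e, true) = x} := by
    unfold numLoops
    rw [← card_image_of_injective _ h.injective, ← Set.ncard_coe_finset]
    congr 1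
    ext e
    rw [mem_loopSet, ← isLink_self_iff, h.isLink_iff]
    simp only [coe_image, Set.mem_image, mem_coe, mem_filter, mem_univ, true_and]
    constructor
    · rintro ⟨⟨e, b⟩, h1, rfl, h2, h3⟩
      refine ⟨e, ⟨h1, ?_⟩, rfl⟩
      cases b
      · exact ⟨h2, h3⟩
      · exact ⟨h3, h2⟩
    · rintro ⟨e, ⟨h1, h2, h3⟩, rfl⟩
      exact ⟨(e, false), h1, rfl, h2, h3⟩
  have h2 : dartMult p T x x =
      #(({e : E | e ∈ T ∧ p (e, false) = x ∧ p (e, true) = x} : Finset E) ×ˢ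
        (univ : Finset Bool)) := by
    unfold dartMult
    congr 1
    ext ⟨e, b⟩
    simp only [mem_filter, mem_product, mem_univ, true_and, and_true]
    cases b
    · rfl
    · exact and_congr_right fun _ => and_comm
  rw [h1, h2, card_product, mul_comm]
  simp

theorem DartEnds.deg_eq [Fintype E] {G : Graph γ δ} {ι : E → δ} {T : Set E} {p : E × Bool → γ}
    (h : G.DartEnds ι T p) (x : γ) : G.deg x = dartDeg p T x := by
  classical
  have h1 : {e | G.IsNonloopAt e x}.ncard =
      #{d : E × Bool | (d.1 ∈ T ∧ p d = x) ∧ ¬ p (dartFlip d) = x} := by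
    rw [← card_image_of_injOn (f := fun d : E × Bool => ι d.1), ← Set.ncard_coe_finset]
    · congr 1
      ext e
      simp only [Set.mem_ofPred_eq, IsNonloopAt, h.isLink_iff, coe_image, Set.mem_image, mem_coe,
        mem_filter, mem_univ, true_and]
      constructor
      · rintro ⟨y, hy, d, h1, h2, h3, rfl⟩
        exact ⟨d, ⟨⟨h1, h3⟩, hy⟩, h2⟩
      · rintro ⟨d, ⟨⟨h1, h3⟩, hy⟩, h2⟩
        exact ⟨_, hy, d, h1, h2, h3, rfl⟩
    · intro d hd d' hd' he
      simp only [mem_coe, mem_filter, mem_univ, true_and] at hd hd'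
      rcases eq_or_eq_dartFlip (h.injective he) with e | e
      · exact e.symm
      · rw [e] at hd'
        exact absurd hd'.1.2 hd.2
  unfold deg
  rw [h1, h.two_mul_numLoops_eq]
  unfold dartMult dartDeg
  rw [← card_filter_add_card_filter_not (s := {d : E × Bool | d.1 ∈ T ∧ p d = x})
    (fun d => p (dartFlip d) = x), filter_filter, filter_filter, add_comm]
  congr 2
  ext d
  simp [and_assoc]

theorem DartEnds.colorClass {G : Graph γ δ} {ι : E → δ} {p : E × Bool → γ}
    (h : G.DartEnds ι Set.univ p) (c : δ → C) (j : C) :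
    (G.colorClass c j).DartEnds ι {e | c (ι e) = j} p where
  injective := h.injective
  edgeSet_eq := by
    ext e
    rw [edge_mem_iff_exists_isLink]
    constructor
    · rintro ⟨x, y, hl, hc⟩
      obtain ⟨d, -, rfl, -⟩ := h.isLink_iff.1 hl
      exact ⟨d.1, hc, rfl⟩
    · rintro ⟨e, hc, rfl⟩
      exact ⟨_, _, h.isLink (e, false) trivial, hc⟩
  isLink d hd := ⟨h.isLink d trivial, hd⟩

theorem DartEnds.mem_vertexSet_colorClass {G : Graph γ δ} {ι : E → δ} {p : E × Bool → γ}
    (h : G.DartEnds ι Set.univ p) {c : δ → C} {j : C} {x : γ} :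
    x ∈ V(G.colorClass c j) ↔ ∃ d : E × Bool, c (ι d.1) = j ∧ p d = x := by
  constructor
  · rintro ⟨e, ⟨y, hl⟩, hc⟩
    obtain ⟨d, -, rfl, rfl, -⟩ := h.isLink_iff.1 hl
    exact ⟨d, hc, rfl⟩
  · rintro ⟨d, hc, rfl⟩
    exact ⟨ι d.1, ⟨_, h.isLink d trivial⟩, hc⟩

/-- If darts of color `j` at one vertex of the amalgamation are joined in color `j` in the
detachment, then the numbers of components of color `j` agree. -/
theorem numComponents_colorClass_eq {H : Graph α β} {G : Graph γ δ} {ι₀ : E → β} {ι : E → δ}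
    {p₀ : E × Bool → α} {p : E × Bool → γ} (h₀ : H.DartEnds ι₀ Set.univ p₀)
    (h : G.DartEnds ι Set.univ p) (c₀ : β → C) (c : δ → C) (hc : ∀ e, c₀ (ι₀ e) = c (ι e))
    (φ : γ → α) (hφ : ∀ d, φ (p d) = p₀ d) (j : C)
    (hj : ∀ d d', DartAdj p₀ (c ∘ ι) j d d' → Relation.EqvGen (DartAdj p (c ∘ ι) j) d d') :
    (G.colorClass c j).numComponents = (H.colorClass c₀ j).numComponents := by
  have mem : ∀ d : E × Bool, c (ι d.1) = j → p d ∈ V(G.colorClass c j) :=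
    fun d hd => h.mem_vertexSet_colorClass.2 ⟨d, hd, rfl⟩
  let F : V(G.colorClass c j) → V(H.colorClass c₀ j) := fun x => ⟨φ x, by
    obtain ⟨d, hd, hx⟩ := h.mem_vertexSet_colorClass.1 x.2
    exact h₀.mem_vertexSet_colorClass.2 ⟨d, (hc _).trans hd, by rw [← hx, hφ]⟩⟩
  have hF : ∀ x y : V(G.colorClass c j), (G.colorClass c j).Adj x y →
      (H.colorClass c₀ j).Adj (F x) (F y) := by
    rintro x y ⟨e, hl, he⟩
    obtain ⟨d, -, rfl, h1, h2⟩ := h.isLink_iff.1 hl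
    refine ⟨ι₀ d.1, ?_, (hc _).trans he⟩
    simp only [F, ← h1, ← h2, hφ]
    exact h₀.isLink d trivial
  have color : ∀ d d', Relation.EqvGen (DartAdj p (c ∘ ι) j) d d' →
      (c (ι d.1) = j ↔ c (ι d'.1) = j) := by
    intro d d' hd
    induction hd with
    | rel _ _ h' => exact ⟨fun _ => h'.2.1, fun _ => h'.1⟩
    | refl _ => rfl
    | symm _ _ _ ih => exact ih.symm
    | trans _ _ _ _ _ ih ih' => exact ih.trans ih'
  have down : ∀ d d', Relation.EqvGen (DartAdj p (c ∘ ι) j) d d' → ∀ (hd : c (ι d.1) = j)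
      (hd' : c (ι d'.1) = j),
      Quot.mk (fun x y : V(G.colorClass c j) => (G.colorClass c j).Adj x y) ⟨p d, mem d hd⟩ =
        Quot.mk _ ⟨p d', mem d' hd'⟩ := by
    intro d d' hd
    induction hd with
    | rel d d' h' =>
      intro hd hd'
      obtain ⟨-, -, rfl | e⟩ := h'
      · exact Quot.sound ⟨ι d.1, h.isLink d trivial, hd⟩
      · congr 2
    | refl _ => intro _ _; rfl
    | symm _ _ _ ih => exact fun a b => (ih b a).symm
    | trans _ _ _ h1 _ ih ih' =>
      exact fun a b => (ih a ((color _ _ h1).1 a)).trans (ih' ((color _ _ h1).1 a) b)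
  -- A walk in `H` lifts to a chain of darts: `hj` replaces each passage through a vertex of `H`,
  -- where the detachment may have separated the darts.
  have up : ∀ x y : V(H.colorClass c₀ j),
      Relation.EqvGen (fun x y : V(H.colorClass c₀ j) => (H.colorClass c₀ j).Adj x y) x y →
      ∀ d d', c (ι d.1) = j → c (ι d'.1) = j → p₀ d = x → p₀ d' = y →
        Relation.EqvGen (DartAdj p (c ∘ ι) j) d d' := by
    intro x y hxy
    induction hxy with
    | rel x y h' =>
      intro d d' hd hd' e e'
      obtain ⟨f, hl, hf⟩ := h'
      obtain ⟨b, -, rfl, h1, h2⟩ := h₀.isLink_iff.1 hl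
      have hb : c (ι b.1) = j := (hc _).symm.trans hf
      exact ((hj d b ⟨hd, hb, .inr (e.trans h1.symm)⟩).trans _ _ _
        (.rel b (dartFlip b) ⟨hb, hb, .inl rfl⟩)).trans _ _ _
        (hj (dartFlip b) d' ⟨hb, hd', .inr (h2.trans e'.symm)⟩)
    | refl x => exact fun d d' hd hd' e e' => hj d d' ⟨hd, hd', .inr (e.trans e'.symm)⟩
    | symm _ _ _ ih => exact fun d d' hd hd' e e' => (ih d' d hd' hd e' e).symm
    | trans x y z _ _ ih ih' =>
      intro d d' hd hd' e e'
      obtain ⟨b, hb, hb'⟩ := h₀.mem_vertexSet_colorClass.1 y.2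
      have hb'' : c (ι b.1) = j := (hc _).symm.trans hb
      exact (ih d b hd hb'' e hb').trans _ _ _ (ih' b d' hb'' hd' hb' e')
  refine Nat.card_congr (Equiv.ofBijective (Quot.map F hF) ⟨?_, ?_⟩)
  · rintro ⟨x, hx⟩ ⟨y, hy⟩ hxy
    obtain ⟨d, hd, rfl⟩ := h.mem_vertexSet_colorClass.1 hx
    obtain ⟨d', hd', rfl⟩ := h.mem_vertexSet_colorClass.1 hy
    exact down d d' (up _ _ (Quot.eqvGen_exact hxy) d d' hd hd' (hφ d).symm (hφ d').symm) hd hd'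
  · rintro ⟨x, hx⟩
    obtain ⟨d, hd, rfl⟩ := h₀.mem_vertexSet_colorClass.1 hx
    exact ⟨Quot.mk _ ⟨p d, mem d ((hc _).symm.trans hd)⟩,
      congrArg (Quot.mk _) (Subtype.ext (hφ d))⟩

/-- The floor and the ceiling of the quotient are the decisive values of `L`. -/
theorem approx_div_of_fairShare {D n d : ℕ} (hn : 0 < n) (h : FairShare D n d 1) :
    Approx d (D / n) := by
  have hn' : (0 : ℝ) < n := by exact_mod_cast hn
  have h0 : (0 : ℝ) ≤ (D : ℝ) / n := by positivity
  constructor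
  · rw [← natCast_floor_eq_intCast_floor h0]
    have h1 := (h ⌊(D : ℝ) / n⌋₊).1 (by
      have := Nat.floor_le h0
      rw [le_div_iff₀ hn'] at this
      exact_mod_cast this)
    rw [mul_one] at h1
    exact_mod_cast h1
  · rw [← natCast_ceil_eq_intCast_ceil h0]
    have h1 := (h ⌈(D : ℝ) / n⌉₊).2 (by
      have := Nat.le_ceil ((D : ℝ) / n)
      rw [div_le_iff₀ hn'] at this
      exact_mod_cast this)
    rw [mul_one] at h1
    exact_mod_cast h1

theorem approx_div_choose_of_fairShare {l n d : ℕ} (hn : 2 ≤ n)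
    (h : FairShare (2 * l) (n * (n - 1)) d 1) : Approx d (l / n.choose 2) := by
  have e : (l : ℝ) / (n.choose 2 : ℕ) = ((2 * l : ℕ) : ℝ) / ((n * (n - 1) : ℕ) : ℝ) := by
    rw [Nat.cast_choose_two, Nat.cast_mul, Nat.cast_mul, Nat.cast_sub (by omega)]
    push_cast
    rw [div_div_eq_mul_div, mul_comm]
  rw [e]
  exact approx_div_of_fairShare (Nat.mul_pos (by omega) (by omega)) h

end Graph

/-! ### Passing from graphs to darts and back. -/

namespace Graph

/-- Choosing an orientation of every edge gives the ends of the darts of a graph. -/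
theorem exists_dartEnds {α β : Type*} (H : Graph α β) :
    ∃ p : E(H) × Bool → α, H.DartEnds ((↑) : E(H) → β) Set.univ p := by
  choose s t hst using fun e : E(H) => H.exists_isLink_of_mem_edgeSet e.2
  refine ⟨fun d => if d.2 then t d.1 else s d.1, Subtype.val_injective, by simp, ?_⟩
  rintro ⟨e, b⟩ -
  cases b
  · simpa [dartFlip] using hst e
  · simpa [dartFlip] using (hst e).symm

/-- The graph with vertex set `V` in which the edges `e : E` have the ends `p (e, false)` and
`p (e, true)`. -/
def ofDarts {E γ : Type*} (V : Set γ) (p : E × Bool → γ) (hp : ∀ d, p d ∈ V) : Graph γ E where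
  vertexSet := V
  IsLink e x y := ∃ d : E × Bool, d.1 = e ∧ p d = x ∧ p (dartFlip d) = y
  isLink_symm := fun _ _ => ⟨by
    rintro x y ⟨d, rfl, rfl, rfl⟩
    exact ⟨dartFlip d, rfl, rfl, by simp⟩⟩
  eq_or_eq_of_isLink_of_isLink := by
    rintro e x y v w ⟨d, rfl, rfl, rfl⟩ ⟨d', h, rfl, rfl⟩
    rcases eq_or_eq_dartFlip h.symm with rfl | rfl <;> simp
  left_mem_of_isLink := by
    rintro e x y ⟨d, rfl, rfl, rfl⟩
    exact hp d

theorem dartEnds_ofDarts {E γ : Type*} (V : Set γ) (p : E × Bool → γ) (hp : ∀ d, p d ∈ V) :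
    (ofDarts V p hp).DartEnds id Set.univ p where
  injective := Function.injective_id
  edgeSet_eq := by
    ext e
    simp only [Set.image_id, Set.mem_univ, iff_true]
    exact ⟨_, _, (e, false), rfl, rfl, rfl⟩
  isLink d _ := ⟨d, rfl, rfl, rfl⟩

end Graph

/-! ### Assembly of the theorem. -/

theorem theorem3p1 {α : Type u} {β : Type v} (H : Graph α β)
    (hV : V(H).Finite) (hE : E(H).Finite)
    -- an edge-colouring of `H` with `k` colours
    (k : ℕ) (c : β → Fin k)
    (η : α → ℕ) (hη : ∀ w ∈ V(H), 0 < η w)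
    (hloop : ∀ w ∈ V(H), η w = 1 → H.numLoops w = 0) :
    ∃ (γ : Type u) (δ : Type v) (G : Graph γ δ) (ψ : γ → α) (ψ' : δ → β),
      V(G).Finite ∧ E(G).Finite ∧ G.Loopless ∧ G.IsDetachment H η ψ ψ' ∧
      -- degrees in `G`
      (∀ w ∈ V(H), ∀ u ∈ V(G), ψ u = w →
        Graph.Approx (G.deg u) (H.deg w / η w)) ∧
      -- degrees in the colour classes; the edge `e` of `G` has the colour of the edge `ψ' e` of `H`
      (∀ w ∈ V(H), ∀ u ∈ V(G), ψ u = w → ∀ j : Fin k,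
        Graph.Approx ((G.colorClass (c ∘ ψ') j).deg u) ((H.colorClass c j).deg w / η w)) ∧
      -- multiplicities within a fibre, in `G`
      (∀ w ∈ V(H), 2 ≤ η w → ∀ u ∈ V(G), ∀ u' ∈ V(G), ψ u = w → ψ u' = w → u ≠ u' →
        Graph.Approx (G.mult u u') (H.numLoops w / (η w).choose 2)) ∧
      -- multiplicities within a fibre, in the colour classes
      (∀ w ∈ V(H), 2 ≤ η w → ∀ u ∈ V(G), ∀ u' ∈ V(G), ψ u = w → ψ u' = w → u ≠ u' →
        ∀ j : Fin k, Graph.Approx ((G.colorClass (c ∘ ψ') j).mult u u')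
          ((H.colorClass c j).numLoops w / (η w).choose 2)) ∧
      -- multiplicities between fibres, in `G`
      (∀ w ∈ V(H), ∀ z ∈ V(H), w ≠ z → ∀ u ∈ V(G), ∀ v ∈ V(G), ψ u = w → ψ v = z →
        Graph.Approx (G.mult u v) (H.mult w z / (η w * η z))) ∧
      -- multiplicities between fibres, in the colour classes
      (∀ w ∈ V(H), ∀ z ∈ V(H), w ≠ z → ∀ u ∈ V(G), ∀ v ∈ V(G), ψ u = w → ψ v = z →
        ∀ j : Fin k, Graph.Approx ((G.colorClass (c ∘ ψ') j).mult u v)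
          ((H.colorClass c j).mult w z / (η w * η z))) ∧
      -- components of the colour classes
      (∀ j : Fin k,
        (∀ w ∈ V(H), ∃ n : ℤ, Even n ∧ ((H.colorClass c j).deg w : ℝ) / η w = n) →
        (G.colorClass (c ∘ ψ') j).numComponents = (H.colorClass c j).numComponents) := by
  classical
  obtain ⟨p₀, h₀⟩ := H.exists_dartEnds
  have : Fintype E(H) := hE.fintype
  have hp₀ : ∀ d, p₀ d ∈ V(H) := fun d => (h₀.isLink d trivial).left_mem
  let c' : E(H) → Fin k := fun e => c e
  let J : Set (Fin k) := {j | ∀ w ∈ V(H), ∃ n : ℤ, Even n ∧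
    ((H.colorClass c j).deg w : ℝ) / η w = n}
  have h₀c : ∀ j, (H.colorClass c j).DartEnds ((↑) : E(H) → β) {e | c' e = j} p₀ :=
    fun j => h₀.colorClass c j
  have hJ : ∀ j ∈ J, ∀ w, ∃ m, dartDeg p₀ {e | c' e = j} w = 2 * m * η w := by
    intro j hj w
    by_cases hw : w ∈ V(H)
    · obtain ⟨n, ⟨r, rfl⟩, hr⟩ := hj w hw
      have hη' : (0 : ℝ) < η w := by exact_mod_cast hη w hw
      rw [(h₀c j).deg_eq, div_eq_iff hη'.ne'] at hr
      have hr' : (dartDeg p₀ {e | c' e = j} w : ℤ) = (r + r) * η w := by exact_mod_cast hr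
      have hr0 : 0 ≤ r := by
        by_contra! hlt
        have : (0 : ℤ) < η w := by exact_mod_cast hη w hw
        nlinarith
      lift r to ℕ using hr0
      refine ⟨r, ?_⟩
      rw [two_mul]
      exact_mod_cast hr'
    · have hne : ∀ d, p₀ d ≠ w := fun d hd => hw (hd ▸ hp₀ d)
      exact ⟨0, by rw [dartDeg_eq_zero hne]; simp⟩
  obtain ⟨p, hp⟩ := exists_detaches c' J hV.toFinset η (by simpa using hη) p₀
    (by simpa using hp₀) hJ
  set κ : α × ℕ → ℕ := fun u => if u.1 ∈ hV.toFinset ∧ u.2 < η u.1 then 1 else 0 with hκ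
  have hκ1 : ∀ w ∈ V(H), ∀ i < η w, κ (w, i) = 1 := fun w hw i hi => by simp [hκ, hw, hi]
  let V : Set (α × ℕ) := {u | u.1 ∈ V(H) ∧ u.2 < η u.1}
  have hpV : ∀ d, p d ∈ V := by
    intro d
    have h1 : (p d).1 ∈ V(H) := by rw [hp.map]; exact hp₀ d
    refine ⟨h1, ?_⟩
    by_contra hlt
    -- Outside `V` the final weight is zero, so no dart ends there.
    exact hp.ne_of_weight_eq_zero (u := p d) (by simp only [hκ, hlt, and_false, if_false]) (hη _ h1) d rfl
  let G := Graph.ofDarts V p hpV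
  have h : G.DartEnds id Set.univ p := Graph.dartEnds_ofDarts V p hpV
  have hc : ∀ j, (G.colorClass (c ∘ Subtype.val) j).DartEnds id {e | c' e = j} p :=
    fun j => h.colorClass _ j
  have memT : ∀ j, {e | c' e = j} ∈ colorSets c' := fun j => .inr ⟨j, rfl⟩
  have memU : Set.univ ∈ colorSets c' := .inl rfl
  have deg : ∀ T ∈ colorSets c', ∀ w ∈ V(H), ∀ u ∈ V, u.1 = w →
      FairShare (dartDeg p₀ T w) (η w) (dartDeg p T u) 1 := by
    rintro T hT w hw ⟨w, i⟩ hu rfl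
    exact (hp.deg T hT (w, i)).congr rfl rfl rfl (hκ1 w hw i hu.2).symm
  have inner : ∀ T ∈ colorSets c', ∀ w ∈ V(H), ∀ u ∈ V, ∀ u' ∈ V, u.1 = w → u'.1 = w → u ≠ u' →
      FairShare (dartMult p₀ T w w) (η w * (η w - 1)) (dartMult p T u u') 1 := by
    rintro T hT w hw ⟨w, i⟩ hu ⟨w', i'⟩ hu' rfl h1 hne
    obtain rfl : w' = w := h1
    refine (hp.mult T hT (w', i) (w', i')).congr rfl (pairWeight_self _ _).symm rfl ?_
    rw [pairWeight_of_ne _ hne, hκ1 _ hw i hu.2, hκ1 _ hw i' hu'.2]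
  have outer : ∀ T ∈ colorSets c', ∀ w ∈ V(H), ∀ z ∈ V(H), w ≠ z → ∀ u ∈ V, ∀ v ∈ V, u.1 = w →
      v.1 = z → FairShare (dartMult p₀ T w z) (η w * η z) (dartMult p T u v) 1 := by
    rintro T hT w hw z hz hne ⟨w, i⟩ hu ⟨z, i'⟩ hv rfl rfl
    refine (hp.mult T hT (w, i) (z, i')).congr rfl (pairWeight_of_ne _ hne).symm rfl ?_
    rw [pairWeight_of_ne _ fun e => hne (congrArg Prod.fst e), hκ1 _ hw i hu.2, hκ1 _ hz i' hv.2]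
  have loopless : ∀ u ∈ V, dartMult p Set.univ u u = 0 := by
    rintro ⟨w, i⟩ ⟨hw, hi⟩
    have hw' : 0 < η w := hη w hw
    -- A single part has pair weight `1 * 0` with itself, so any upper bound `U` forces its loop
    -- count to zero. Such a `U` exists because `pairWeight η w w` vanishes only for `η w = 1`,
    -- where `hloop` excludes loops.
    obtain ⟨U, hU⟩ : ∃ U, dartMult p₀ Set.univ w w ≤ U * pairWeight η w w := by
      rw [pairWeight_self]
      rcases Nat.lt_or_ge (η w) 2 with h2 | h2
      · refine ⟨0, ?_⟩
        rw [← h₀.two_mul_numLoops_eq, hloop w hw (by omega), mul_zero, zero_mul]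
      · exact ⟨_, Nat.le_mul_of_pos_right _ (Nat.mul_pos hw' (by omega))⟩
    have := (hp.mult _ memU (w, i) (w, i) U).2 hU
    rw [pairWeight_self, hκ1 w hw i hi] at this
    simpa using this
  have neST : ∀ {w z : α} {u v : α × ℕ}, w ≠ z → u.1 = w → v.1 = z → u ≠ v := by
    rintro w z u v hne rfl rfl e
    exact hne (congrArg Prod.fst e)
  refine ⟨α × ℕ, E(H), G, Prod.fst, Subtype.val, ?_, Set.toFinite _, ?_, ⟨⟨?_, ?_, ?_⟩, ?_⟩,
    ?_, ?_, ?_, ?_, ?_, ?_, ?_⟩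
  · refine (hV.biUnion fun w _ => (Set.finite_lt_nat (η w)).image fun i => (w, i)).subset ?_
    rintro ⟨w, i⟩ hu
    exact Set.mem_biUnion hu.1 ⟨i, hu.2, rfl⟩
  · refine ⟨fun e u hl => ?_⟩
    obtain ⟨d, -, -, h1, h2⟩ := h.isLink_iff.1 hl
    refine Finset.notMem_empty d ?_
    rw [← Finset.card_eq_zero.1 (loopless u hl.vertex_mem)]
    simp [h1, h2]
  · ext w
    constructor
    · rintro ⟨u, hu, rfl⟩
      exact hu.1
    · exact fun hw => ⟨(w, 0), ⟨hw, hη w hw⟩, rfl⟩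
  · refine ⟨fun e _ => e.2, Subtype.val_injective.injOn, fun e he => ⟨⟨e, he⟩, ?_, rfl⟩⟩
    rw [h.edgeSet_eq]
    simp
  · intro e u v hl
    obtain ⟨d, -, rfl, rfl, rfl⟩ := h.isLink_iff.1 hl
    rw [hp.map, hp.map]
    exact h₀.isLink d trivial
  · intro w hw
    have : {u ∈ V(G) | u.1 = w} = (fun i => (w, i)) '' (Finset.range (η w) : Set ℕ) := by
      ext ⟨z, i⟩
      simp only [Set.mem_image, Finset.coe_range, Set.mem_Iio, Prod.mk.injEq]
      constructor
      · rintro ⟨h1, rfl⟩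
        exact ⟨i, h1.2, rfl, rfl⟩
      · rintro ⟨i, h1, rfl, rfl⟩
        exact ⟨⟨hw, h1⟩, rfl⟩
    rw [this, Set.ncard_image_of_injective _ (Prod.mk_right_injective w), Set.ncard_coe_finset,
      Finset.card_range]
  · intro w hw u hu huw
    rw [h₀.deg_eq, h.deg_eq]
    exact Graph.approx_div_of_fairShare (hη w hw) (deg _ memU w hw u hu huw)
  · intro w hw u hu huw j
    rw [(h₀c j).deg_eq, (hc j).deg_eq]
    exact Graph.approx_div_of_fairShare (hη w hw) (deg _ (memT j) w hw u hu huw)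
  · intro w hw h2 u hu u' hu' huw huw' hne
    rw [h.mult_eq hne]
    refine Graph.approx_div_choose_of_fairShare h2 ?_
    rw [h₀.two_mul_numLoops_eq]
    exact inner _ memU w hw u hu u' hu' huw huw' hne
  · intro w hw h2 u hu u' hu' huw huw' hne j
    rw [(hc j).mult_eq hne]
    refine Graph.approx_div_choose_of_fairShare h2 ?_
    rw [(h₀c j).two_mul_numLoops_eq]
    exact inner _ (memT j) w hw u hu u' hu' huw huw' hne
  · intro w hw z hz hne u hu v hv huw hvz
    rw [h.mult_eq (neST hne huw hvz), h₀.mult_eq hne, ← Nat.cast_mul]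
    exact Graph.approx_div_of_fairShare (Nat.mul_pos (hη w hw) (hη z hz))
      (outer _ memU w hw z hz hne u hu v hv huw hvz)
  · intro w hw z hz hne u hu v hv huw hvz j
    rw [(hc j).mult_eq (neST hne huw hvz), (h₀c j).mult_eq hne, ← Nat.cast_mul]
    exact Graph.approx_div_of_fairShare (Nat.mul_pos (hη w hw) (hη z hz))
      (outer _ (memT j) w hw z hz hne u hu v hv huw hvz)
  · intro j hj
    exact Graph.numComponents_colorClass_eq h₀ h c (c ∘ Subtype.val) (fun _ => rfl) Prod.fst hp.map j
      (hp.joined j hj)
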